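/- Let $A$ be a $C^*$-algebra, let $k\in\mathbb N_0$, and let $\mathbb E=(\mathbb E(n))_{n\in\mathbb N_0^k}$ be a product system of essential $C^*$-correspondences over $A$, with $\mathbb E(0)=A$ and coordinate correspondences $E_i=\mathbb E(e_i)$, $1\le i\le k$; the multiplication of $\mathbb E$ induces isomorphisms $\mathbb E(m)\otimes_A\mathbb E(n)\cong\mathbb E(m+n)$, and hence isomorphisms $t_{i,j}:E_i\otimes_A E_j\to E_j\otimes_A E_i$. Let $(\sigma,T^{(1)},\dots,T^{(k)})$ be an isometric representation of $\mathbb E$ on a Hilbert space $H$. That is, $\sigma:A\to B(H)$ is a nondegenerate $*$-representation and the $T^{(i)}:E_i\to B(H)$ are linear maps with $$T^{(i)}(a\xi b)=\sigma(a)T^{(i)}(\xi)\sigma(b),\qquad T^{(i)}(\xi)^*T^{(i)}(\eta)=\sigma(\langle\xi,\eta\rangle)$$ for all $a,b\in A$, $\xi,\eta\in E_i$, and, with $\widetilde T^{(i)}:E_i\otimes_\sigma H\to H$, $\widetilde T^{(i)}(\xi\otimes h)=T^{(i)}(\xi)h$, $$\widetilde T^{(i)}\bigl(I_{E_i}\otimes\widetilde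 T^{(j)}\bigr)=\widetilde T^{(j)}\bigl(I_{E_j}\otimes\widetilde T^{(i)}\bigr)(t_{i,j}\otimes I_H)\qquad\text{for all } i,j .$$ The representation is not assumed to be doubly commuting. Let $\alpha\subseteq\{1,\dots,k\}$. Consider the closed subspaces $K\subseteq H$ with the following three properties. 1. $K$ reduces $(\sigma,T^{(1)},\dots,T^{(k)})$: both $K$ and $K^\perp$ are invariant under all operators $\sigma(a)$, $a\in A$, and $T^{(i)}(\xi)$, $\xi\in E_i$, $1\le i\le k$. 2. The restriction $(\sigma,(T^{(i)})_{i\in\alpha})|_K$ is isomorphic (unitarily equivalent) to an induced representation of the subsystem $\mathbb E_\alpha=(\mathbb E(n))_{n\in\mathbb N_0^k,\ n_i=0\text{ for } i\notin\alpha}$. Here the representation of $\mathbb E_\alpha$ induced by a nondegenerate representation $\pi$ of $A$ on a Hilbert space $K_0$ acts on $\mathcal F(\mathbb E_\alpha)\otimes_\pi K_0$, where $\mathcal F(\mathbb E_\alpha)=\bigoplus_{n}\mathbb E_\alpha(n)$ is the Fock module; in it $a\in A$ acts as the left action of $a$ on $\mathcal F(\mathbb E_\alpha)$ tensored with $I_{K_0}$,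 and $\xi\in E_i$ ($i\in\alpha$) acts as the creation operator $\eta\mapsto\xi\eta$ tensored with $I_{K_0}$. 3. For every $i\notin\alpha$ the restriction $(\sigma,T^{(i)})|_K$ is fully coisometric, i.e. the operator $\widetilde{T^{(i)}|_K}:E_i\otimes_{\sigma|_K}K\to K$ satisfies $\widetilde{T^{(i)}|_K}\,\bigl(\widetilde{T^{(i)}|_K}\bigr)^*=I_K$. Then there is a unique maximal subspace among them: there is a closed subspace $H_\alpha\subseteq H$ that has the properties 1–3 and contains every closed subspace with these properties, and every closed subspace that is maximal (with respect to inclusion) among those with the properties 1–3 equals $H_\alpha$. -/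

import Mathlib

open scoped TensorProduct InnerProductSpace
set_option linter.unusedSectionVars false

noncomputable section

namespace CorrProd

/-- A right pre-Hilbert module over the C*-algebra `A`: `ip x y` is the `A`-valued inner product
`⟨x, y⟩`, linear in the second variable, and `rsmul a x` is the right action `x · a`.
(The inner product of Mathlib's `CStarModule` satisfies `⟨x, a • y⟩ = a * ⟨x, y⟩`; for a
noncommutative `A` that is the left-handed notion, hence this class.) -/
class PreHilbertModule (A E : Type*) [NonUnitalCStarAlgebra A] [PartialOrder A]
    [StarOrderedRing A] [AddCommGroup E] [Module ℂ E] where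
  ip : E →ₗ⋆[ℂ] E →ₗ[ℂ] A
  rsmul : A →ₗ[ℂ] E →ₗ[ℂ] E
  rsmul_mul : ∀ (a b : A) (x : E), rsmul (a * b) x = rsmul b (rsmul a x)
  ip_rsmul : ∀ (x y : E) (a : A), ip x (rsmul a y) = ip x y * a
  star_ip : ∀ x y : E, star (ip x y) = ip y x
  ip_self_nonneg : ∀ x : E, 0 ≤ ip x x

section positivity
variable {A E : Type*} [NonUnitalCStarAlgebra A] [PartialOrder A] [StarOrderedRing A]
  [AddCommGroup E] [Module ℂ E] [PreHilbertModule A E]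

open PreHilbertModule

theorem rsmul_ip (x y : E) (a : A) : ip (rsmul a x) y = star a * ip (A := A) x y := by
  rw [← star_ip, ip_rsmul, star_mul, star_ip]

/-- A negative part of a self-adjoint element. -/
theorem exists_negPart {B : Type*} [NonUnitalCStarAlgebra B] [PartialOrder B] [StarOrderedRing B]
    {G : B} (hG : IsSelfAdjoint G) :
    ∃ N : B, 0 ≤ N ∧ N * G * N = -(N * N * N) ∧ (N = 0 → 0 ≤ G) := by
  refine ⟨G⁻, CFC.negPart_nonneg G, ?_, fun h => ?_⟩
  · have h1 : G⁻ * G = -(G⁻ * G⁻) := by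
      conv_lhs => rw [← CFC.posPart_sub_negPart G hG, mul_sub]
      rw [CFC.posPart_sub_negPart G hG, CFC.negPart_mul_posPart, zero_sub]
    rw [h1, neg_mul]
  · rw [← CFC.posPart_sub_negPart G hG, h, sub_zero]; exact CFC.posPart_nonneg G

theorem exists_sqrt {B : Type*} [NonUnitalCStarAlgebra B] [PartialOrder B] [StarOrderedRing B]
    {G : B} (hG : 0 ≤ G) : ∃ b : B, G = star b * b :=
  CStarAlgebra.nonneg_iff_eq_star_mul_self.mp hG

/-- The Gram matrix of a finite family in a pre-Hilbert module is positive in `M_n(A)`,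
written as a factorization `B* B`. -/
theorem gram_factor {n : ℕ} (x : Fin n → E) :
    ∃ b : Fin n → Fin n → A, ∀ i j, ip (A := A) (x i) (x j) = ∑ l, star (b l i) * b l j := by
  classical
  let G : CStarMatrix (Fin n) (Fin n) A := CStarMatrix.ofMatrix fun i j => ip (x i) (x j)
  have hG : IsSelfAdjoint G := by
    ext i j
    exact star_ip _ _
  obtain ⟨N, hN0, hPN, hNG⟩ := exists_negPart hG
  have hNs : star N = N := (IsSelfAdjoint.of_nonneg hN0).star_eq
  have h3 : 0 ≤ N * N * N := by
    have := star_left_conjugate_nonneg hN0 N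
    rwa [hNs] at this
  obtain ⟨S, hS⟩ := exists_sqrt h3
  have hd : ∀ p, 0 ≤ (N * G * N) p p := by
    intro p
    have : (N * G * N) p p =
        ip (A := A) (∑ i, rsmul (N i p) (x i)) (∑ j, rsmul (N j p) (x j)) := by
      have hst : ∀ i, N p i = star (N i p) := fun i => by
        conv_lhs => rw [← hNs, CStarMatrix.star_apply]
      simp only [CStarMatrix.mul_apply, map_sum, LinearMap.sum_apply, ip_rsmul, rsmul_ip,
        Finset.sum_mul]
      simp only [hst]
      rfl
    rw [this]; exact ip_self_nonneg _
  have hS0 : ∀ l p, S l p = 0 := by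
    intro l p
    have h5 : (N * G * N) p p = -∑ l, star (S l p) * S l p := by
      rw [hPN, hS]; simp [CStarMatrix.mul_apply, CStarMatrix.star_apply]
    have h6 : ∑ l, star (S l p) * S l p = 0 :=
      le_antisymm (by have := hd p; rw [h5] at this; simpa using this)
        (Finset.sum_nonneg fun l _ => star_mul_self_nonneg _)
    have h7 := (Finset.sum_eq_zero_iff_of_nonneg
      (fun l _ => star_mul_self_nonneg (S l p))).mp h6 l (Finset.mem_univ _)
    exact CStarRing.star_mul_self_eq_zero_iff _ |>.mp h7
  have hSz : S = 0 := by ext l p; exact hS0 l p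
  have hN3 : N * N * N = 0 := by rw [hS, hSz, mul_zero]
  have hN2 : N * N = 0 := by
    have : star (N * N) * (N * N) = 0 := by
      rw [star_mul, hNs, ← mul_assoc, hN3, zero_mul]
    exact CStarRing.star_mul_self_eq_zero_iff _ |>.mp this
  have hN1 : N = 0 := by
    have : star N * N = 0 := by rw [hNs, hN2]
    exact CStarRing.star_mul_self_eq_zero_iff _ |>.mp this
  have hGn : 0 ≤ G := hNG hN1
  obtain ⟨B, hB⟩ := exists_sqrt hGn
  refine ⟨fun i j => B i j, fun i j => ?_⟩
  have : G i j = (star B * B) i j := by rw [hB]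
  rw [show ip (A := A) (x i) (x j) = G i j from rfl, this]
  simp [CStarMatrix.mul_apply, CStarMatrix.star_apply]

/-- For `0 ≤ c` with `‖c‖ ≤ 1` there is a self-adjoint `b` with, formally, `(1 - b)² = 1 - c`. -/
theorem exists_sqrt_compl {c : A} (hc : 0 ≤ c) (hc1 : ‖c‖ ≤ 1) :
    ∃ b : A, star b = b ∧ b + b - b * b = c := by
  let f : ℝ → ℝ := fun t => 1 - √(1 - t)
  have hcs : IsSelfAdjoint c := .of_nonneg hc
  have hf : Continuous f := by fun_prop
  have hf0 : f 0 = 0 := by simp [f]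
  refine ⟨cfcₙ f c, (cfcₙ_predicate f c : IsSelfAdjoint _).star_eq, ?_⟩
  rw [← cfcₙ_add f f (a := c), ← cfcₙ_mul f f (a := c), ← cfcₙ_sub _ _ (a := c)]
  conv_rhs => rw [← cfcₙ_id' ℝ c]
  refine cfcₙ_congr fun t ht => ?_
  have ht1 : t ≤ 1 := by
    have := NonUnitalIsometricContinuousFunctionalCalculus.norm_quasispectrum_le (𝕜 := ℝ) c ht
    exact (le_abs_self t).trans (this.trans hc1)
  have := Real.mul_self_sqrt (show 0 ≤ 1 - t by linarith)
  simp only [f]; nlinarith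

end positivity

section interior

variable {A E F K : Type*} [NonUnitalCStarAlgebra A] [PartialOrder A] [StarOrderedRing A]
  [AddCommGroup E] [Module ℂ E] [PreHilbertModule A E]
  [AddCommGroup F] [Module ℂ F] [PreHilbertModule A F]
  [NormedAddCommGroup K] [InnerProductSpace ℂ K] [CompleteSpace K]

open PreHilbertModule

/-- The algebraic tensor product `E ⊗_ℂ K`, a type synonym that remembers the representation `π`. -/
def AlgTensor (E : Type*) [AddCommGroup E] [Module ℂ E]
    (_π : A →⋆ₙₐ[ℂ] (K →L[ℂ] K)) : Type _ := E ⊗[ℂ] K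

variable (π : A →⋆ₙₐ[ℂ] (K →L[ℂ] K))

instance : AddCommGroup (AlgTensor E π) := inferInstanceAs (AddCommGroup (E ⊗[ℂ] K))
instance : Module ℂ (AlgTensor E π) := inferInstanceAs (Module ℂ (E ⊗[ℂ] K))

/-- The sesquilinear form with `⟨x ⊗ h, y ⊗ k⟩ = ⟨h, π(⟨x, y⟩) k⟩`. -/
def tensorForm : E ⊗[ℂ] K →ₗ⋆[ℂ] E ⊗[ℂ] K →ₗ[ℂ] ℂ :=
  TensorProduct.lift (LinearMap.mk₂'ₛₗ (starRingEnd ℂ) (starRingEnd ℂ)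
    (fun x h => TensorProduct.lift (LinearMap.mk₂ ℂ (fun y k => ⟪h, π (ip x y) k⟫_ℂ)
      (by simp) (by simp) (by simp) (by simp)))
    (by intros; ext; simp) (by intros; ext; simp)
    (by intros; ext; simp) (by intros; ext; simp [mul_comm]))

theorem tensorForm_tmul (x y : E) (h k : K) :
    tensorForm π (x ⊗ₜ h) (y ⊗ₜ k) = ⟪h, π (ip x y) k⟫_ℂ := rfl

theorem tensorForm_self_nonneg (v : E ⊗[ℂ] K) : 0 ≤ (tensorForm π v v).re := by
  obtain ⟨n, x, h, rfl⟩ := TensorProduct.exists_sum_tmul_eq v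
  obtain ⟨b, hb⟩ := gram_factor (A := A) x
  have : tensorForm π (∑ j, x j ⊗ₜ[ℂ] h j) (∑ j, x j ⊗ₜ[ℂ] h j) =
      ∑ l, ⟪∑ i, π (b l i) (h i), ∑ j, π (b l j) (h j)⟫_ℂ := by
    simp only [map_sum, LinearMap.sum_apply, tensorForm_tmul, hb, map_mul, map_star,
      sum_apply, inner_sum, sum_inner, mul_apply_eq_comp,
      ContinuousLinearMap.star_eq_adjoint, ContinuousLinearMap.adjoint_inner_right]
    conv_rhs => rw [Finset.sum_comm]
    refine Finset.sum_congr rfl fun i _ => ?_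
    rw [Finset.sum_comm]
  rw [this, Complex.re_sum]
  exact Finset.sum_nonneg fun l _ => inner_self_nonneg (𝕜 := ℂ)

theorem tensorForm_conj (v w : E ⊗[ℂ] K) :
    (starRingEnd ℂ) (tensorForm π w v) = tensorForm π v w := by
  induction v with
  | zero => simp
  | add v v' h h' => simp [h, h']
  | tmul x h =>
    induction w with
    | zero => simp
    | add v v' h h' => simp [h, h']
    | tmul y k =>
      rw [tensorForm_tmul, tensorForm_tmul, inner_conj_symm, ← star_ip, map_star,
        ContinuousLinearMap.star_eq_adjoint, ContinuousLinearMap.adjoint_inner_left]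

/-- The pre-inner product on the algebraic tensor product. -/
@[reducible] def tensorCore : PreInnerProductSpace.Core ℂ (AlgTensor E π) where
  inner v w := tensorForm π v w
  conj_inner_symm v w := tensorForm_conj π v w
  re_inner_nonneg v := tensorForm_self_nonneg π v
  add_left u v w := by
    exact congr($(map_add (tensorForm π) u v) w)
  smul_left u v c := by
    exact congr($(map_smulₛₗ (tensorForm π) c u) v)

instance : SeminormedAddCommGroup (AlgTensor E π) :=
  @InnerProductSpace.Core.toSeminormedAddCommGroup ℂ _ _ _ _ (tensorCore π)

instance : InnerProductSpace ℂ (AlgTensor E π) := InnerProductSpace.ofCore (tensorCore π)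

theorem AlgTensor.inner_def (v w : AlgTensor E π) : ⟪v, w⟫_ℂ = tensorForm π v w := rfl

variable (E) in
/-- The Hilbert space `E ⊗_π K` (interior tensor product): the Hausdorff completion of `E ⊗_ℂ K` for
the pre-inner product `⟨x ⊗ h, y ⊗ k⟩ = ⟨h, π(⟨x, y⟩) k⟩`. -/
abbrev InteriorTensor : Type _ := UniformSpace.Completion (AlgTensor E π)

/-- The identification of `E ⊗ K` with its type synonym. -/
def AlgTensor.mk : E ⊗[ℂ] K ≃ₗ[ℂ] AlgTensor E π := LinearEquiv.refl ℂ (E ⊗[ℂ] K)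

theorem AlgTensor.induction {p : AlgTensor E π → Prop} (v : AlgTensor E π)
    (zero : p 0) (mk : ∀ (x : E) (h : K), p (AlgTensor.mk π (x ⊗ₜ h)))
    (add : ∀ v w, p v → p w → p (v + w)) : p v :=
  TensorProduct.induction_on (motive := p) v zero mk add

theorem AlgTensor.inner_mk (x y : E) (h k : K) :
    ⟪AlgTensor.mk π (x ⊗ₜ h), AlgTensor.mk π (y ⊗ₜ k)⟫_ℂ = ⟪h, π (ip x y) k⟫_ℂ := rfl

/-- The elementary tensor `x ⊗ h` in `E ⊗_π K`. -/
def tmul (x : E) (h : K) : InteriorTensor E π :=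
  (AlgTensor.mk π (x ⊗ₜ h) : AlgTensor E π)

theorem inner_tmul (x y : E) (h k : K) :
    ⟪tmul π x h, tmul π y k⟫_ℂ = ⟪h, π (ip x y) k⟫_ℂ := by
  rw [tmul, tmul, UniformSpace.Completion.inner_coe, AlgTensor.inner_mk]

/-- The map `L ⊗ I` on algebraic tensor products. -/
def AlgTensor.map (L : E →ₗ[ℂ] F) : AlgTensor E π →ₗ[ℂ] AlgTensor F π :=
  (AlgTensor.mk π).toLinearMap ∘ₗ LinearMap.rTensor K L ∘ₗ (AlgTensor.mk π).symm.toLinearMap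

theorem AlgTensor.map_mk (L : E →ₗ[ℂ] F) (x : E) (h : K) :
    AlgTensor.map π L (AlgTensor.mk π (x ⊗ₜ h)) = AlgTensor.mk π (L x ⊗ₜ h) := rfl

theorem AlgTensor.inner_map {G : Type*} [AddCommGroup G] [Module ℂ G] [PreHilbertModule A G]
    (L : E →ₗ[ℂ] G) (L' : F →ₗ[ℂ] G) (N : F →ₗ[ℂ] E)
    (hN : ∀ x y, ip (A := A) (L x) (L' y) = ip x (N y)) (v : AlgTensor E π) (w : AlgTensor F π) :
    ⟪AlgTensor.map π L v, AlgTensor.map π L' w⟫_ℂ = ⟪v, AlgTensor.map π N w⟫_ℂ := by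
  induction v using AlgTensor.induction with
  | zero => simp
  | add v v' h h' => simp only [map_add, inner_add_left, h, h']
  | mk x h =>
    induction w using AlgTensor.induction with
    | zero => simp
    | add v v' h h' => simp only [map_add, inner_add_right, h, h']
    | mk y k => simp only [AlgTensor.map_mk, AlgTensor.inner_mk, hN]

/-- Two bounded operators on an interior tensor product that agree on elementary tensors agree. -/
theorem InteriorTensor.ext {G : Type*} [NormedAddCommGroup G] [NormedSpace ℂ G]
    {S S' : InteriorTensor E π →L[ℂ] G} (h : ∀ x k, S (tmul π x k) = S' (tmul π x k)) :
    S = S' := by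
  ext v
  induction v using UniformSpace.Completion.induction_on with
  | hp => exact isClosed_eq S.continuous S'.continuous
  | ih v =>
    induction v using AlgTensor.induction with
    | zero => rw [UniformSpace.Completion.coe_zero, map_zero, map_zero]
    | add v w hv hw => simp only [UniformSpace.Completion.coe_add, map_add, hv, hw]
    | mk x k => exact h x k

/-- The extension to the interior tensor product of a bounded map on the algebraic one. -/
def InteriorTensor.lift {G : Type*} [NormedAddCommGroup G] [NormedSpace ℂ G] [CompleteSpace G]
    (f : AlgTensor E π →L[ℂ] G) : InteriorTensor E π →L[ℂ] G :=
  f.extend (UniformSpace.Completion.toComplL (𝕜 := ℂ) (E := AlgTensor E π))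

theorem InteriorTensor.lift_coe {G : Type*} [NormedAddCommGroup G] [NormedSpace ℂ G]
    [CompleteSpace G] (f : AlgTensor E π →L[ℂ] G) (v : AlgTensor E π) :
    InteriorTensor.lift π f v = f v :=
  f.extend_eq (e := UniformSpace.Completion.toComplL (𝕜 := ℂ) (E := AlgTensor E π))
    UniformSpace.Completion.denseRange_coe (UniformSpace.Completion.isUniformInducing_coe _) v

/-- The bounded operator `L ⊗ I` on interior tensor products,
for `L` such that `L ⊗ I` is bounded by `c`. -/
def InteriorTensor.map (L : E →ₗ[ℂ] F) (c : ℝ)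
    (hc : ∀ v : AlgTensor E π, ‖AlgTensor.map π L v‖ ≤ c * ‖v‖) :
    InteriorTensor E π →L[ℂ] InteriorTensor F π :=
  InteriorTensor.lift π (UniformSpace.Completion.toComplL.comp
    ((AlgTensor.map π L).mkContinuous c hc))

theorem InteriorTensor.map_coe (L : E →ₗ[ℂ] F) (c : ℝ)
    (hc : ∀ v : AlgTensor E π, ‖AlgTensor.map π L v‖ ≤ c * ‖v‖) (v : AlgTensor E π) :
    InteriorTensor.map π L c hc v = (AlgTensor.map π L v : AlgTensor F π) := by
  rw [InteriorTensor.map, InteriorTensor.lift_coe]; rfl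

theorem InteriorTensor.map_tmul (L : E →ₗ[ℂ] F) (c : ℝ)
    (hc : ∀ v : AlgTensor E π, ‖AlgTensor.map π L v‖ ≤ c * ‖v‖) (x : E) (h : K) :
    InteriorTensor.map π L c hc (tmul π x h) = tmul π (L x) h :=
  InteriorTensor.map_coe π L c hc _

/-- A `*`-representation of `A` by linear maps on a pre-Hilbert space is bounded. -/
theorem re_inner_le_of_star_rep {V : Type*} [SeminormedAddCommGroup V] [InnerProductSpace ℂ V]
    (l : A →ₗ[ℂ] V →ₗ[ℂ] V) (hmul : ∀ a b v, l (a * b) v = l a (l b v))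
    (hadj : ∀ a v w, ⟪l a v, w⟫_ℂ = ⟪v, l (star a) w⟫_ℂ) {c : A} (hc : 0 ≤ c) (v : V) :
    (⟪v, l c v⟫_ℂ).re ≤ ‖c‖ * ‖v‖ ^ 2 := by
  by_cases h0 : ‖c‖ = 0
  · have : c = 0 := by simpa using h0
    simp [this]
  have hp : 0 < ‖c‖ := lt_of_le_of_ne (norm_nonneg _) (Ne.symm h0)
  have hd : 0 ≤ ((‖c‖⁻¹ : ℝ) : ℂ) • c := by
    rw [Complex.coe_smul]
    exact smul_nonneg (inv_nonneg.mpr hp.le) hc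
  have hd1 : ‖((‖c‖⁻¹ : ℝ) : ℂ) • c‖ ≤ 1 := by
    rw [norm_smul, Complex.norm_real, norm_inv, norm_norm, inv_mul_cancel₀ h0]
  obtain ⟨b, hbs, hb⟩ := exists_sqrt_compl hd hd1
  have h1 : ⟪v - l b v, v - l b v⟫_ℂ = ⟪v, v⟫_ℂ - ⟪v, l (((‖c‖⁻¹ : ℝ) : ℂ) • c) v⟫_ℂ := by
    rw [← hb]
    simp only [map_add, map_sub, LinearMap.add_apply, LinearMap.sub_apply, hmul, inner_sub_left,
      inner_sub_right, inner_add_right, hadj, hbs]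
    ring
  have h2 : 0 ≤ (⟪v - l b v, v - l b v⟫_ℂ).re := inner_self_nonneg (𝕜 := ℂ)
  rw [h1, map_smul, LinearMap.smul_apply, inner_smul_right, Complex.sub_re,
    Complex.re_ofReal_mul] at h2
  have h3 : (⟪v, v⟫_ℂ).re = ‖v‖ ^ 2 := (norm_sq_eq_re_inner (𝕜 := ℂ) v).symm
  rw [h3, sub_nonneg, inv_mul_le_iff₀ hp] at h2
  exact h2

end interior

section corr

/-- A C*-correspondence over `A`: a (complete) right Hilbert `A`-module `E` whose norm is
`‖x‖ = ‖⟨x, x⟩‖^(1/2)`, with a left action `lsmul a x = φ(a) x` that is a `*`-homomorphism into the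
adjointable operators (`φ(a)` has the adjoint `φ(a*)`, so it is automatically right `A`-linear and
bounded), and that is essential: the closed linear span of `φ(A) E` is `E`. -/
class Correspondence (A E : Type*) [NonUnitalCStarAlgebra A] [PartialOrder A]
    [StarOrderedRing A] [NormedAddCommGroup E] [NormedSpace ℂ E]
    extends PreHilbertModule A E where
  complete : CompleteSpace E
  norm_sq : ∀ x : E, ‖x‖ ^ 2 = ‖ip x x‖
  lsmul : A →ₗ[ℂ] E →ₗ[ℂ] E
  lsmul_mul : ∀ (a b : A) (x : E), lsmul (a * b) x = lsmul a (lsmul b x)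
  ip_lsmul : ∀ (a : A) (x y : E), ip (lsmul a x) y = ip x (lsmul (star a) y)
  essential : (Submodule.span ℂ {z : E | ∃ a x, z = lsmul a x}).topologicalClosure = ⊤

open PreHilbertModule Correspondence

/-- A product system of C*-correspondences over `A`, indexed by an additive commutative monoid `M`:
correspondences `X m` with an associative multiplication `X m × X n → X (m + n)` that induces
isomorphisms `X m ⊗_A X n ≅ X (m + n)` (i.e. it is bilinear, compatible with the inner product of
the interior tensor product, and has dense range; the module actions are respected by
associativity), and with `X 0 = A` acting through the module structure.
`mul h x y` is the product, landing in `X p` whenever `h : m + n = p`. -/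
structure ProductSystem (A : Type*) {M : Type*} (X : M → Type*) [NonUnitalCStarAlgebra A]
    [PartialOrder A] [StarOrderedRing A] [AddCommMonoid M] [∀ m, NormedAddCommGroup (X m)]
    [∀ m, NormedSpace ℂ (X m)] [∀ m, Correspondence A (X m)] where
  mul : ∀ {m n p : M}, m + n = p → X m →ₗ[ℂ] X n →ₗ[ℂ] X p
  mul_assoc : ∀ {m n p q r s : M} (h₁ : m + n = q) (h₂ : q + p = s) (h₃ : n + p = r)
    (h₄ : m + r = s) (x : X m) (y : X n) (z : X p),
    mul h₂ (mul h₁ x y) z = mul h₄ x (mul h₃ y z)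
  ip_mul : ∀ {m n p : M} (h : m + n = p) (x x' : X m) (y y' : X n),
    ip (A := A) (mul h x y) (mul h x' y') = ip y (lsmul (ip (A := A) x x') y')
  dense_mul : ∀ {m n p : M} (h : m + n = p),
    (Submodule.span ℂ {z : X p | ∃ x y, z = mul h x y}).topologicalClosure = ⊤
  one : A ≃ₗ[ℂ] X 0
  ip_one : ∀ a b : A, ip (one a) (one b) = star a * b
  one_mul : ∀ {m : M} (a : A) (x : X m), mul (zero_add m) (one a) x = lsmul a x
  mul_one : ∀ {m : M} (a : A) (x : X m), mul (add_zero m) x (one a) = rsmul a x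

variable {A M : Type*} {X : M → Type*} [NonUnitalCStarAlgebra A]
    [PartialOrder A] [StarOrderedRing A] [AddCommMonoid M] [∀ m, NormedAddCommGroup (X m)]
    [∀ m, NormedSpace ℂ (X m)] [∀ m, Correspondence A (X m)]

/-- The product subsystem given by the fibres over a submonoid. -/
def ProductSystem.restrict (P : ProductSystem A X) (S : AddSubmonoid M) :
    ProductSystem A (fun m : S => X m) where
  mul h := P.mul (congrArg Subtype.val h)
  mul_assoc h₁ h₂ h₃ h₄ := P.mul_assoc (congrArg Subtype.val h₁) (congrArg Subtype.val h₂)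
    (congrArg Subtype.val h₃) (congrArg Subtype.val h₄)
  ip_mul h := P.ip_mul (congrArg Subtype.val h)
  dense_mul h := P.dense_mul (congrArg Subtype.val h)
  one := P.one
  ip_one := P.ip_one
  one_mul := P.one_mul
  mul_one := P.mul_one

end corr


section fock

open PreHilbertModule Correspondence

theorem dfinsupp_induction {M : Type*} {X : M → Type*} [DecidableEq M] [∀ m, AddCommGroup (X m)]
    {p : (Π₀ m, X m) → Prop} (x : Π₀ m, X m) (zero : p 0)
    (single : ∀ m (y : X m), p (DFinsupp.single m y)) (add : ∀ y z, p y → p z → p (y + z)) :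
    p x :=
  DFinsupp.induction x zero fun m y _ _ _ hf => add _ _ (single m y) hf

variable {A M : Type*} {X : M → Type*} [NonUnitalCStarAlgebra A] [PartialOrder A]
  [StarOrderedRing A]

open scoped Classical in
/-- The algebraic direct sum `⨁ X m` as a right pre-Hilbert module, with
`⟨x, y⟩ = ∑ m, ⟨x m, y m⟩`. For the fibres of a product system this is
the dense submodule of finitely supported elements of the Fock module. -/
instance instPreHilbertDFinsupp [∀ m, AddCommGroup (X m)] [∀ m, Module ℂ (X m)]
    [∀ m, PreHilbertModule A (X m)] : PreHilbertModule A (Π₀ m, X m) where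
  ip :=
    { toFun := fun x => DFinsupp.lsum ℂ fun m => ip (x m)
      map_add' := fun x y => by
        rw [← map_add]; congr 1; ext m z; simp
      map_smul' := fun c x => by
        rw [← map_smul]; congr 1; ext m z; simp }
  rsmul := LinearMap.mk₂ ℂ (fun a x => DFinsupp.mapRange.linearMap (fun m => rsmul a) x)
    (by intros; ext; simp) (by intros; ext; simp) (by intros; ext; simp) (by intros; ext; simp)
  rsmul_mul a b x := by ext m; simp [rsmul_mul]
  ip_rsmul x y a := by
    induction y using dfinsupp_induction with
    | zero => simp
    | add f g hf hg => simp only [map_add, hf, hg, add_mul]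
    | single i y => simp [ip_rsmul]
  star_ip x y := by
    induction y using dfinsupp_induction with
    | zero =>
      have h0 : (DFinsupp.lsum ℂ fun m => ip (A := A) ((0 : Π₀ m, X m) m)) = 0 := by ext; simp
      rw [map_zero, star_zero]; exact congr($h0 x).symm
    | add f g hf hg => simp only [map_add, LinearMap.add_apply, ← hf, ← hg, star_add]
    | single i y =>
      induction x using dfinsupp_induction with
      | zero => simp
      | add f g hf hg => simp only [map_add, LinearMap.add_apply, ← hf, ← hg, star_add]
      | single j x =>
        by_cases h : i = j
        · subst h; simp [star_ip]
        · have h' : j ≠ i := fun e => h e.symm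
          simp [h, h']
  ip_self_nonneg x := by
    simp only [LinearMap.coe_mk, AddHom.coe_mk, DFinsupp.lsum_apply_apply, DFinsupp.sumAddHom_apply]
    exact Finset.sum_nonneg fun m _ => ip_self_nonneg _

open scoped Classical in
theorem dfinsupp_ip_single [∀ m, AddCommGroup (X m)] [∀ m, Module ℂ (X m)]
    [∀ m, PreHilbertModule A (X m)] (x : Π₀ m, X m) (m : M) (y : X m) :
    ip (A := A) x (DFinsupp.single m y) = ip (x m) y :=
  DFinsupp.lsum_single ℂ _ _ _

variable [∀ m, NormedAddCommGroup (X m)] [∀ m, NormedSpace ℂ (X m)] [∀ m, Correspondence A (X m)]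

/-- The (diagonal) left action `φ_∞` of `A` on the Fock module. -/
def fockLsmul : A →ₗ[ℂ] (Π₀ m, X m) →ₗ[ℂ] (Π₀ m, X m) :=
  LinearMap.mk₂ ℂ (fun a x => DFinsupp.mapRange.linearMap (fun _ => lsmul a) x)
    (by intros; ext; simp) (by intros; ext; simp) (by intros; ext; simp) (by intros; ext; simp)

open scoped Classical in
theorem fockLsmul_single (a : A) (m : M) (x : X m) :
    fockLsmul a (DFinsupp.single m x) = DFinsupp.single m (lsmul a x) := by
  simp [fockLsmul]

open scoped Classical in
theorem ip_fockLsmul (a : A) (x y : Π₀ m, X m) :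
    ip (A := A) (fockLsmul a x) y = ip x (fockLsmul (star a) y) := by
  induction y using dfinsupp_induction with
  | zero => simp
  | add f g hf hg => simp only [map_add, hf, hg]
  | single i y =>
    rw [fockLsmul_single, dfinsupp_ip_single, dfinsupp_ip_single, ← ip_lsmul]
    simp [fockLsmul]

theorem fockLsmul_mul (a b : A) (x : Π₀ m, X m) :
    fockLsmul (a * b) x = fockLsmul a (fockLsmul b x) := by
  ext m; simp [fockLsmul, lsmul_mul]

variable [AddCommMonoid M]

open scoped Classical in
/-- The creation operator `T_ξ` on the Fock module, `T_ξ x = ξ x ∈ X (m + n)` for `x ∈ X n`. -/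
def ProductSystem.creation (P : ProductSystem A X) {m : M} (ξ : X m) :
    (Π₀ n, X n) →ₗ[ℂ] (Π₀ n, X n) :=
  DFinsupp.lsum ℂ fun n => DFinsupp.lsingle (m + n) ∘ₗ P.mul rfl ξ

open scoped Classical in
theorem ProductSystem.creation_single (P : ProductSystem A X) {m : M} (ξ : X m) (n : M) (x : X n) :
    P.creation ξ (DFinsupp.single n x) = DFinsupp.single (m + n) (P.mul rfl ξ x) := by
  simp [ProductSystem.creation]

open scoped Classical in
theorem ProductSystem.ip_creation [IsCancelAdd M] (P : ProductSystem A X) {m : M} (ξ η : X m)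
    (x y : Π₀ n, X n) :
    ip (A := A) (P.creation ξ x) (P.creation η y) = ip x (fockLsmul (ip (A := A) ξ η) y) := by
  induction y using dfinsupp_induction with
  | zero => simp
  | add f g hf hg => simp only [map_add, hf, hg]
  | single i y =>
    rw [P.creation_single, fockLsmul_single, dfinsupp_ip_single, dfinsupp_ip_single]
    induction x using dfinsupp_induction with
    | zero => simp
    | add f g hf hg => simp only [map_add, DFinsupp.add_apply, LinearMap.add_apply, hf, hg]
    | single j x =>
      rw [P.creation_single]
      by_cases h : j = i
      · subst h; simp [P.ip_mul]
      · rw [DFinsupp.single_eq_of_ne (fun e => h (add_left_cancel e).symm),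
          DFinsupp.single_eq_of_ne (Ne.symm h)]
        simp

end fock

section rep

open PreHilbertModule Correspondence
open ContinuousLinearMap (adjoint)

/-- A representation `π` of `A` on `H` is nondegenerate if `π(A) H` has dense linear span. -/
def IsNondegenerate {A H : Type*} [NonUnitalCStarAlgebra A] [NormedAddCommGroup H]
    [InnerProductSpace ℂ H] [CompleteSpace H] (π : A →⋆ₙₐ[ℂ] (H →L[ℂ] H)) : Prop :=
  (Submodule.span ℂ {z : H | ∃ a h, z = π a h}).topologicalClosure = ⊤

variable {A M ι : Type*} {X : M → Type*} [NonUnitalCStarAlgebra A] [PartialOrder A]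
  [StarOrderedRing A] [AddCommMonoid M] [∀ m, NormedAddCommGroup (X m)]
  [∀ m, NormedSpace ℂ (X m)] [∀ m, Correspondence A (X m)]

/-- An isometric representation `(σ, (T i)_i)`, on the Hilbert space `H`, of the product system `P`,
in terms of its coordinate correspondences `E_i = X (g i)` (for a product system over `ℕ^k`, `g i` is
the `i`-th basis element). Complete contractivity of `T i` is automatic from `isometric`.

In `commute`, `E_i ⊗ E_j ≅ X (g i + g j) ≅ E_j ⊗ E_i` by multiplication, and the condition is
`T̃_i (I ⊗ T̃_j) = T̃_j (I ⊗ T̃_i) (t_{i,j} ⊗ I)` for the resulting unitary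
`t_{i,j} : E_i ⊗ E_j → E_j ⊗ E_i`: the maps `ξ ⊗ η ↦ T_i(ξ) T_j(η)` and
`η ⊗ ξ ↦ T_j(η) T_i(ξ)` are one and the same bounded map on `X (g i + g j)`. -/
structure IsometricRep (P : ProductSystem A X) (g : ι → M) (H : Type*) [NormedAddCommGroup H]
    [InnerProductSpace ℂ H] [CompleteSpace H] where
  σ : A →⋆ₙₐ[ℂ] (H →L[ℂ] H)
  nondegenerate : IsNondegenerate σ
  T : ∀ i, X (g i) →ₗ[ℂ] (H →L[ℂ] H)
  T_lsmul : ∀ i a ξ, T i (lsmul a ξ) = σ a ∘L T i ξ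
  T_rsmul : ∀ i a ξ, T i (rsmul a ξ) = T i ξ ∘L σ a
  isometric : ∀ i ξ η, adjoint (T i ξ) ∘L T i η = σ (ip ξ η)
  commute : ∀ i j, ∃ S : X (g i + g j) →L[ℂ] (H →L[ℂ] H),
    (∀ ξ η, S (P.mul rfl ξ η) = T i ξ ∘L T j η) ∧
    (∀ ξ η, S (P.mul (add_comm (g j) (g i)) η ξ) = T j η ∘L T i ξ)

section fockrep

variable {K : Type*} [NormedAddCommGroup K] [InnerProductSpace ℂ K] [CompleteSpace K]
  (π : A →⋆ₙₐ[ℂ] (K →L[ℂ] K))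

variable (X) in
/-- The Hilbert space `F(X) ⊗_π K`, where `F(X) = ⨁ X m` is the Fock module. (The interior tensor
product is a completion, so `F(X)` may be replaced by its dense algebraic part.) -/
abbrev FockSpace : Type _ := InteriorTensor (Π₀ m, X m) π

theorem norm_map_fockLsmul_sq (c : A) (hc : 0 ≤ c) (v : AlgTensor (Π₀ m, X m) π) :
    (⟪v, AlgTensor.map π (fockLsmul c) v⟫_ℂ).re ≤ ‖c‖ * ‖v‖ ^ 2 := by
  let l : A →ₗ[ℂ] AlgTensor (Π₀ m, X m) π →ₗ[ℂ] AlgTensor (Π₀ m, X m) π :=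
    { toFun := fun a => AlgTensor.map π (fockLsmul a)
      map_add' := fun a b => by simp [AlgTensor.map, LinearMap.rTensor_add, LinearMap.add_comp,
        LinearMap.comp_add]
      map_smul' := fun a b => by simp [AlgTensor.map, LinearMap.rTensor_smul, LinearMap.smul_comp,
        LinearMap.comp_smul] }
  refine re_inner_le_of_star_rep l (fun a b v => ?_) (fun a v w => ?_) hc v
  · change AlgTensor.map π (fockLsmul (a * b)) v =
      AlgTensor.map π (fockLsmul a) (AlgTensor.map π (fockLsmul b) v)
    induction v using AlgTensor.induction with
    | zero => simp
    | add v w hv hw => simp only [map_add, hv, hw]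
    | mk x h => simp only [AlgTensor.map_mk, fockLsmul_mul]
  · have h1 := AlgTensor.inner_map π (fockLsmul a) LinearMap.id (fockLsmul (star a))
      (fun x y => ip_fockLsmul a x y) v w
    have h2 : AlgTensor.map π (LinearMap.id : (Π₀ m, X m) →ₗ[ℂ] _) w = w := by
      simp [AlgTensor.map]
    rwa [h2] at h1

theorem norm_map_fockLsmul_le (a : A) (v : AlgTensor (Π₀ m, X m) π) :
    ‖AlgTensor.map π (fockLsmul a) v‖ ≤ ‖a‖ * ‖v‖ := by
  have h1 := AlgTensor.inner_map π (fockLsmul a) (fockLsmul a) (fockLsmul (star a * a))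
    (fun x y => by rw [ip_fockLsmul, ← fockLsmul_mul]) v v
  have h2 := norm_map_fockLsmul_sq π (star a * a) (star_mul_self_nonneg a) v
  rw [← h1, CStarRing.norm_star_mul_self] at h2
  have h3 := norm_sq_eq_re_inner (𝕜 := ℂ) (AlgTensor.map π (fockLsmul a) v)
  change _ = (inner ℂ _ _).re at h3
  rw [← h3] at h2
  refine abs_le_of_sq_le_sq' ?_ (by positivity) |>.2
  nlinarith

theorem norm_map_creation_le [IsCancelAdd M] (P : ProductSystem A X) {m : M} (ξ : X m)
    (v : AlgTensor (Π₀ m, X m) π) :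
    ‖AlgTensor.map π (P.creation ξ) v‖ ≤ ‖ξ‖ * ‖v‖ := by
  have h1 := AlgTensor.inner_map π (P.creation ξ) (P.creation ξ) (fockLsmul (ip (A := A) ξ ξ))
    (fun x y => P.ip_creation ξ ξ x y) v v
  have h2 := norm_map_fockLsmul_sq π (ip (A := A) ξ ξ) (ip_self_nonneg ξ) v
  rw [← h1, ← norm_sq] at h2
  have h3 := norm_sq_eq_re_inner (𝕜 := ℂ) (AlgTensor.map π (P.creation ξ) v)
  change _ = (inner ℂ _ _).re at h3
  rw [← h3] at h2
  refine abs_le_of_sq_le_sq' ?_ (by positivity) |>.2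
  nlinarith

/-- The operator `φ_∞(a) ⊗ I` on the Fock space. -/
def fockSigma (a : A) : FockSpace X π →L[ℂ] FockSpace X π :=
  InteriorTensor.map π (fockLsmul a) ‖a‖ (norm_map_fockLsmul_le π a)

theorem fockSigma_tmul (a : A) (x : Π₀ m, X m) (h : K) :
    fockSigma π a (tmul π x h) = tmul π (fockLsmul a x) h :=
  InteriorTensor.map_tmul ..

/-- The operator `T_ξ ⊗ I` on the Fock space. -/
def fockCreation [IsCancelAdd M] (P : ProductSystem A X) {m : M} (ξ : X m) :
    FockSpace X π →L[ℂ] FockSpace X π :=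
  InteriorTensor.map π (P.creation ξ) ‖ξ‖ (norm_map_creation_le π P ξ)

theorem fockCreation_tmul [IsCancelAdd M] (P : ProductSystem A X) {m : M} (ξ : X m)
    (x : Π₀ m, X m) (h : K) :
    fockCreation π P ξ (tmul π x h) = tmul π (P.creation ξ x) h :=
  InteriorTensor.map_tmul ..


end fockrep
end rep

section induced

open PreHilbertModule Correspondence
open ContinuousLinearMap (adjoint)

section aux
variable {A E K G : Type*} [NonUnitalCStarAlgebra A] [PartialOrder A] [StarOrderedRing A]
  [AddCommGroup E] [Module ℂ E] [PreHilbertModule A E]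
  [NormedAddCommGroup K] [InnerProductSpace ℂ K] [CompleteSpace K]
  [NormedAddCommGroup G] [InnerProductSpace ℂ G] [CompleteSpace G]
  (π : A →⋆ₙₐ[ℂ] (K →L[ℂ] K))

theorem tmul_add_left (x y : E) (h : K) : tmul π (x + y) h = tmul π x h + tmul π y h := by
  rw [tmul, TensorProduct.add_tmul, map_add, UniformSpace.Completion.coe_add]; rfl

theorem tmul_smul_left (c : ℂ) (x : E) (h : K) : tmul π (c • x) h = c • tmul π x h := by
  rw [tmul, ← TensorProduct.smul_tmul', map_smul, UniformSpace.Completion.coe_smul]; rfl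

/-- A closed subspace that contains all elementary tensors is everything. -/
theorem InteriorTensor.eq_top {W : Submodule ℂ (InteriorTensor E π)}
    (hW : IsClosed (W : Set (InteriorTensor E π))) (h : ∀ x k, tmul π x k ∈ W) : W = ⊤ := by
  rw [eq_top_iff]
  rintro v -
  induction v using UniformSpace.Completion.induction_on with
  | hp => exact hW
  | ih v =>
    induction v using AlgTensor.induction with
    | zero => rw [UniformSpace.Completion.coe_zero]; exact W.zero_mem
    | add v w hv hw => rw [UniformSpace.Completion.coe_add]; exact W.add_mem hv hw
    | mk x k => exact h x k

theorem InteriorTensor.adjoint_comp_eq {S S' : InteriorTensor E π →L[ℂ] G}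
    {N : InteriorTensor E π →L[ℂ] InteriorTensor E π}
    (hN : ∀ x y h k, ⟪S (tmul π x h), S' (tmul π y k)⟫_ℂ = ⟪tmul π x h, N (tmul π y k)⟫_ℂ) :
    adjoint S ∘L S' = N := by
  refine InteriorTensor.ext π fun y k => ext_inner_left ℂ fun w => ?_
  rw [ContinuousLinearMap.comp_apply, ContinuousLinearMap.adjoint_inner_right]
  induction w using UniformSpace.Completion.induction_on with
  | hp =>
    have hc : ∀ u : InteriorTensor E π, Continuous fun w => ⟪w, u⟫_ℂ :=
      fun u => continuous_id.inner continuous_const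
    have hS : Continuous fun w => ⟪S w, S' (tmul π y k)⟫_ℂ := S.continuous.inner continuous_const
    exact isClosed_eq hS (hc _)
  | ih v =>
    induction v using AlgTensor.induction with
    | zero => simp [UniformSpace.Completion.coe_zero]
    | add v w hv hw =>
      simp only [UniformSpace.Completion.coe_add, map_add, inner_add_left, hv, hw]
    | mk x h => exact hN x y h k

theorem InteriorTensor.norm_map_apply_le {F : Type*} [AddCommGroup F] [Module ℂ F]
    [PreHilbertModule A F] (L : E →ₗ[ℂ] F) (c : ℝ)
    (hc : ∀ v : AlgTensor E π, ‖AlgTensor.map π L v‖ ≤ c * ‖v‖) (v : InteriorTensor E π) :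
    ‖InteriorTensor.map π L c hc v‖ ≤ c * ‖v‖ := by
  induction v using UniformSpace.Completion.induction_on with
  | hp =>
    exact isClosed_le (continuous_norm.comp (InteriorTensor.map π L c hc).continuous)
      (continuous_const.mul continuous_norm)
  | ih v => rw [map_coe, UniformSpace.Completion.norm_coe, UniformSpace.Completion.norm_coe]
            exact hc v

/-- For a linear map `T : E → B(H)` with `T(ξ)* T(η) = σ(⟨ξ, η⟩)`,
the isometry `T̃ : E ⊗ H → H`, `T̃ (ξ ⊗ h) = T(ξ) h`, on the algebraic tensor product. -/
def algTilde (σ : A →⋆ₙₐ[ℂ] (G →L[ℂ] G)) (T : E →ₗ[ℂ] (G →L[ℂ] G)) : AlgTensor E σ →ₗ[ℂ] G :=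
  TensorProduct.lift ((ContinuousLinearMap.coeLM ℂ).comp T) ∘ₗ (AlgTensor.mk σ).symm.toLinearMap

theorem inner_algTilde (σ : A →⋆ₙₐ[ℂ] (G →L[ℂ] G)) (T : E →ₗ[ℂ] (G →L[ℂ] G))
    (hT : ∀ ξ η, adjoint (T ξ) ∘L T η = σ (ip ξ η)) (v w : AlgTensor E σ) :
    ⟪algTilde σ T v, algTilde σ T w⟫_ℂ = ⟪v, w⟫_ℂ := by
  induction v using AlgTensor.induction with
  | zero => simp
  | add v v' h h' => simp only [map_add, inner_add_left, h, h']
  | mk x h =>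
    induction w using AlgTensor.induction with
    | zero => simp
    | add v v' h h' => simp only [map_add, inner_add_right, h, h']
    | mk y k =>
      rw [AlgTensor.inner_mk, ← hT, ContinuousLinearMap.comp_apply,
        ContinuousLinearMap.adjoint_inner_right]
      rfl

theorem norm_algTilde (σ : A →⋆ₙₐ[ℂ] (G →L[ℂ] G)) (T : E →ₗ[ℂ] (G →L[ℂ] G))
    (hT : ∀ ξ η, adjoint (T ξ) ∘L T η = σ (ip ξ η)) (v : AlgTensor E σ) :
    ‖algTilde σ T v‖ ≤ 1 * ‖v‖ := by
  rw [@norm_eq_sqrt_re_inner ℂ, inner_algTilde σ T hT, ← @norm_eq_sqrt_re_inner ℂ, _root_.one_mul]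

/-- The operator `T̃ : E ⊗_σ H → H`. -/
def tilde (σ : A →⋆ₙₐ[ℂ] (G →L[ℂ] G)) (T : E →ₗ[ℂ] (G →L[ℂ] G))
    (hT : ∀ ξ η, adjoint (T ξ) ∘L T η = σ (ip ξ η)) : InteriorTensor E σ →L[ℂ] G :=
  InteriorTensor.lift σ ((algTilde σ T).mkContinuous 1 (norm_algTilde σ T hT))

theorem tilde_tmul (σ : A →⋆ₙₐ[ℂ] (G →L[ℂ] G)) (T : E →ₗ[ℂ] (G →L[ℂ] G))
    (hT : ∀ ξ η, adjoint (T ξ) ∘L T η = σ (ip ξ η)) (ξ : E) (h : G) :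
    tilde σ T hT (tmul σ ξ h) = T ξ h :=
  InteriorTensor.lift_coe σ _ _

end aux

variable {A M ι : Type*} {X : M → Type*} [NonUnitalCStarAlgebra A] [PartialOrder A]
  [StarOrderedRing A] [AddCommMonoid M] [∀ m, NormedAddCommGroup (X m)]
  [∀ m, NormedSpace ℂ (X m)] [∀ m, Correspondence A (X m)]

theorem ProductSystem.mul_lsmul (P : ProductSystem A X) {m n p : M} (h : m + n = p) (a : A)
    (ξ : X m) (x : X n) : P.mul h (lsmul a ξ) x = lsmul a (P.mul h ξ x) := by
  rw [← P.one_mul, ← P.one_mul, P.mul_assoc (zero_add m) h h (zero_add p)]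

theorem ProductSystem.mul_rsmul (P : ProductSystem A X) {m n p : M} (h : m + n = p) (a : A)
    (ξ : X m) (x : X n) : P.mul h (rsmul a ξ) x = P.mul h ξ (lsmul a x) := by
  rw [← P.mul_one, ← P.one_mul, P.mul_assoc (add_zero m) h (zero_add n) h]

open scoped Classical in
theorem ProductSystem.single_mul (P : ProductSystem A X) {m n p : M} (h : m + n = p)
    (ξ : X m) (x : X n) : (DFinsupp.single p (P.mul h ξ x) : Π₀ m, X m) =
      DFinsupp.single (m + n) (P.mul rfl ξ x) := by
  subst h; rfl

theorem ProductSystem.creation_mul (P : ProductSystem A X) {m n p : M} (h : m + n = p)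
    (ξ : X m) (η : X n) (x : Π₀ m, X m) :
    P.creation (P.mul h ξ η) x = P.creation ξ (P.creation η x) := by
  classical
  induction x using dfinsupp_induction with
  | zero => simp
  | add f g hf hg => simp only [map_add, hf, hg]
  | single i x =>
    rw [P.creation_single, P.creation_single, P.creation_single,
      P.mul_assoc h rfl rfl (by rw [← h, add_assoc]), P.single_mul]

theorem ProductSystem.creation_lsmul (P : ProductSystem A X) {m : M} (a : A)
    (ξ : X m) (x : Π₀ m, X m) :
    P.creation (lsmul a ξ) x = fockLsmul a (P.creation ξ x) := by
  classical
  induction x using dfinsupp_induction with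
  | zero => simp
  | add f g hf hg => simp only [map_add, hf, hg]
  | single i x => rw [P.creation_single, P.creation_single, P.mul_lsmul, fockLsmul_single]

theorem ProductSystem.creation_rsmul (P : ProductSystem A X) {m : M} (a : A)
    (ξ : X m) (x : Π₀ m, X m) :
    P.creation (rsmul a ξ) x = P.creation ξ (fockLsmul a x) := by
  classical
  induction x using dfinsupp_induction with
  | zero => simp
  | add f g hf hg => simp only [map_add, hf, hg]
  | single i x => rw [P.creation_single, fockLsmul_single, P.creation_single, P.mul_rsmul]

section fockrep
variable {K : Type*} [NormedAddCommGroup K] [InnerProductSpace ℂ K] [CompleteSpace K]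
  (π : A →⋆ₙₐ[ℂ] (K →L[ℂ] K))

/-- The left action of `A` on the Fock space, as a `*`-representation. -/
def fockSigmaHom : A →⋆ₙₐ[ℂ] (FockSpace X π →L[ℂ] FockSpace X π) where
  toFun := fockSigma π
  map_smul' c a := InteriorTensor.ext π fun x h => by
    simp [fockSigma_tmul, tmul_smul_left]
  map_zero' := InteriorTensor.ext π fun x h => by
    have := tmul_smul_left π 0 x h
    simp only [zero_smul] at this
    simp [fockSigma_tmul, this]
  map_add' a b := InteriorTensor.ext π fun x h => by
    simp [fockSigma_tmul, tmul_add_left]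
  map_mul' a b := InteriorTensor.ext π fun x h => by
    simp [fockSigma_tmul, fockLsmul_mul]
  map_star' a := by
    have := InteriorTensor.adjoint_comp_eq π (S := fockSigma (X := X) π a)
      (S' := ContinuousLinearMap.id ℂ _) (N := fockSigma π (star a)) fun x y h k => by
        simp only [ContinuousLinearMap.id_apply, fockSigma_tmul, inner_tmul, ip_fockLsmul]
    rw [ContinuousLinearMap.star_eq_adjoint, ← this, ContinuousLinearMap.comp_id]

open scoped Classical in
theorem norm_tmul_single_le (m : M) (x : X m) (h : K) :
    ‖tmul π (DFinsupp.single m x) h‖ ≤ ‖h‖ * ‖x‖ := by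
  have h1 := norm_sq_eq_re_inner (𝕜 := ℂ) (tmul π (DFinsupp.single m x : Π₀ m, X m) h)
  rw [inner_tmul, dfinsupp_ip_single, DFinsupp.single_eq_same] at h1
  have h2 : ‖⟪h, π (ip x x) h⟫_ℂ‖ ≤ ‖h‖ * (‖x‖ ^ 2 * ‖h‖) := by
    refine (norm_inner_le_norm _ _).trans ?_
    gcongr
    refine (ContinuousLinearMap.le_opNorm _ _).trans ?_
    gcongr
    rw [norm_sq (A := A)]
    exact NonUnitalStarAlgHom.norm_apply_le π _
  have h3 := RCLike.re_le_norm (⟪h, π (ip x x) h⟫_ℂ)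
  refine abs_le_of_sq_le_sq' ?_ (by positivity) |>.2
  rw [h1]; nlinarith

theorem fockSigmaHom_nondegenerate : IsNondegenerate (fockSigmaHom (X := X) π) := by
  classical
  refine InteriorTensor.eq_top π (Submodule.isClosed_topologicalClosure _) fun x h => ?_
  set W := (Submodule.span ℂ {z | ∃ a v, z = fockSigmaHom (X := X) π a v}).topologicalClosure
  induction x using dfinsupp_induction with
  | zero =>
    have := tmul_smul_left π 0 (0 : Π₀ m, X m) h
    rw [zero_smul, zero_smul] at this
    rw [this]; exact W.zero_mem
  | add x y hx hy => rw [tmul_add_left]; exact W.add_mem hx hy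
  | single m x =>
    let f : X m →L[ℂ] FockSpace X π := LinearMap.mkContinuous
      { toFun := fun x => tmul π (DFinsupp.single m x) h
        map_add' := fun x y => by rw [DFinsupp.single_add, tmul_add_left]
        map_smul' := fun c x => by rw [DFinsupp.single_smul, tmul_smul_left, RingHom.id_apply] }
      ‖h‖ fun x => norm_tmul_single_le π m x h
    have hcl : IsClosed ((W.comap f.toLinearMap : Submodule ℂ (X m)) : Set (X m)) :=
      (Submodule.isClosed_topologicalClosure _).preimage f.continuous
    have := Submodule.topologicalClosure_minimal
      (Submodule.span ℂ {z : X m | ∃ (a : A) (x : X m), z = lsmul a x})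
      (t := W.comap f.toLinearMap) (Submodule.span_le.mpr ?_) hcl
    · rw [essential] at this
      exact this (Submodule.mem_top (x := x))
    · rintro _ ⟨a, x, rfl⟩
      refine Submodule.le_topologicalClosure _ (Submodule.subset_span ⟨a, tmul π
        (DFinsupp.single m x) h, ?_⟩)
      change tmul π (DFinsupp.single m (lsmul a x)) h = fockSigma π a _
      rw [fockSigma_tmul, fockLsmul_single]

variable [IsCancelAdd M]

/-- The map `ξ ↦ T_ξ ⊗ I`. -/
def fockCreationL (P : ProductSystem A X) (m : M) :
    X m →L[ℂ] (FockSpace X π →L[ℂ] FockSpace X π) :=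
  LinearMap.mkContinuous
    { toFun := fun ξ => fockCreation π P ξ
      map_add' := fun ξ η => InteriorTensor.ext π fun x h => by
        rw [add_apply, fockCreation_tmul, fockCreation_tmul,
          fockCreation_tmul, ← tmul_add_left]
        congr 1
        classical
        induction x using dfinsupp_induction with
        | zero => simp
        | add f g hf hg => simp only [map_add, hf, hg]; abel
        | single i x => simp [P.creation_single]
      map_smul' := fun c ξ => InteriorTensor.ext π fun x h => by
        rw [smul_apply, fockCreation_tmul, fockCreation_tmul,
          ← tmul_smul_left]
        congr 1
        classical
        induction x using dfinsupp_induction with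
        | zero => simp
        | add f g hf hg => simp only [map_add, hf, hg, smul_add]
        | single i x => simp [P.creation_single] }
    1 fun ξ => by
      rw [_root_.one_mul]
      exact ContinuousLinearMap.opNorm_le_bound _ (norm_nonneg _)
        (InteriorTensor.norm_map_apply_le π _ _ _)

theorem fockCreationL_tmul (P : ProductSystem A X) {m : M} (ξ : X m) (x : Π₀ m, X m) (h : K) :
    fockCreationL π P m ξ (tmul π x h) = tmul π (P.creation ξ x) h :=
  fockCreation_tmul π P ξ x h

/-- The representation of the product system `P` induced by a representation `π` of `A` on `K`: on
`F(X) ⊗_π K`, with `σ(a) = φ_∞(a) ⊗ I` and `T_i(ξ) = T_ξ ⊗ I`. -/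
def inducedRep (P : ProductSystem A X) (g : ι → M) : IsometricRep P g (FockSpace X π) where
  σ := fockSigmaHom π
  nondegenerate := fockSigmaHom_nondegenerate π
  T i := (fockCreationL π P (g i)).toLinearMap
  T_lsmul i a ξ := InteriorTensor.ext π fun x h => by
    change fockCreationL π P (g i) _ _ = fockSigma π a (fockCreationL π P (g i) _ _)
    simp only [fockCreationL_tmul, fockSigma_tmul, P.creation_lsmul]
  T_rsmul i a ξ := InteriorTensor.ext π fun x h => by
    change fockCreationL π P (g i) _ _ = fockCreationL π P (g i) _ (fockSigma π a _)
    simp only [fockCreationL_tmul, fockSigma_tmul, P.creation_rsmul]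
  isometric i ξ η := InteriorTensor.adjoint_comp_eq π fun x y h k => by
    change ⟪fockCreationL π P (g i) _ _, fockCreationL π P (g i) _ _⟫_ℂ = ⟪_, fockSigma π _ _⟫_ℂ
    simp only [fockCreationL_tmul, fockSigma_tmul, inner_tmul, P.ip_creation]
  commute i j := by
    refine ⟨fockCreationL π P (g i + g j), fun ξ η => InteriorTensor.ext π fun x h => ?_,
      fun ξ η => InteriorTensor.ext π fun x h => ?_⟩
    · change _ = fockCreationL π P (g i) ξ (fockCreationL π P (g j) η _)
      simp only [fockCreationL_tmul, P.creation_mul]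
    · change _ = fockCreationL π P (g j) η (fockCreationL π P (g i) ξ _)
      simp only [fockCreationL_tmul, P.creation_mul]

end fockrep

namespace IsometricRep

universe v

variable {P : ProductSystem A X} {g : ι → M} {H : Type v} [NormedAddCommGroup H]
  [InnerProductSpace ℂ H] [CompleteSpace H]

/-- Isomorphism of representations: a unitary intertwines `σ` and all `T_i(ξ)`. -/
def Isomorphic {H' : Type*} [NormedAddCommGroup H'] [InnerProductSpace ℂ H'] [CompleteSpace H']
    (ρ : IsometricRep P g H) (ρ' : IsometricRep P g H') : Prop :=
  ∃ U : H ≃ₗᵢ[ℂ] H', (∀ a h, U (ρ.σ a h) = ρ'.σ a (U h)) ∧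
    ∀ i ξ h, U (ρ.T i ξ h) = ρ'.T i ξ (U h)

/-- `ρ` is isomorphic to the induced representation of some (nondegenerate) representation `π` of `A`
on a Hilbert space `K`. -/
def IsInduced [IsCancelAdd M] (ρ : IsometricRep P g H) : Prop :=
  ∃ (K : Type v) (_ : NormedAddCommGroup K) (_ : InnerProductSpace ℂ K) (_ : CompleteSpace K)
    (π : A →⋆ₙₐ[ℂ] (K →L[ℂ] K)), IsNondegenerate π ∧ ρ.Isomorphic (inducedRep π P g)

/-- The operator `T̃_i : E_i ⊗_σ H → H`, `T̃_i (ξ ⊗ h) = T_i(ξ) h`. -/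
def tildeT (ρ : IsometricRep P g H) (i : ι) : InteriorTensor (X (g i)) ρ.σ →L[ℂ] H :=
  tilde ρ.σ (ρ.T i) (ρ.isometric i)

/-- The representation `(σ, T_i)` of `E_i` is fully coisometric: `T̃_i T̃_i* = I`. -/
def IsFullyCoisometric (ρ : IsometricRep P g H) (i : ι) : Prop :=
  ρ.tildeT i ∘L adjoint (ρ.tildeT i) = ContinuousLinearMap.id ℂ H

/-- The subspace `L` is invariant under all `σ(a)` and all `T_i(ξ)`. -/
def Invariant (ρ : IsometricRep P g H) (L : Submodule ℂ H) : Prop :=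
  (∀ a, ∀ h ∈ L, ρ.σ a h ∈ L) ∧ ∀ i ξ, ∀ h ∈ L, ρ.T i ξ h ∈ L

theorem Invariant.σ_mem {ρ : IsometricRep P g H} {L : Submodule ℂ H} (hL : ρ.Invariant L) :
    ∀ a, ∀ h ∈ L, ρ.σ a h ∈ L := hL.1

theorem Invariant.T_mem {ρ : IsometricRep P g H} {L : Submodule ℂ H} (hL : ρ.Invariant L) :
    ∀ i ξ, ∀ h ∈ L, ρ.T i ξ h ∈ L := hL.2

/-- The closed subspace `K` reduces `ρ`: `K` and `Kᗮ` are invariant under all `σ(a)` and `T_i(ξ)`. -/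
structure Reduces (ρ : IsometricRep P g H) (K : ClosedSubmodule ℂ H) : Prop where
  invariant : ρ.Invariant K.toSubmodule
  invariant_orthogonal : ρ.Invariant K.toSubmoduleᗮ

instance instCompleteSpaceClosedSubmodule (K : ClosedSubmodule ℂ H) : CompleteSpace K.toSubmodule :=
  inferInstanceAs (CompleteSpace K)

/-- The compression of an operator on `H` to `K`; for an operator that leaves `K` invariant this is
its restriction to `K`. -/
def compress (K : ClosedSubmodule ℂ H) :
    (H →L[ℂ] H) →L[ℂ] (K.toSubmodule →L[ℂ] K.toSubmodule) :=
  (ContinuousLinearMap.compL ℂ K.toSubmodule H K.toSubmodule K.toSubmodule.orthogonalProjectionOnto) ∘L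
    (ContinuousLinearMap.compL ℂ K.toSubmodule H H).flip K.toSubmodule.subtypeL

theorem coe_compress {K : ClosedSubmodule ℂ H} {S : H →L[ℂ] H} {h : K.toSubmodule}
    (hS : S h ∈ K.toSubmodule) : (compress K S h : H) = S h :=
  congrArg Subtype.val
    (Submodule.orthogonalProjectionOnto_mem_subspace_eq_self (K := K.toSubmodule) ⟨S h, hS⟩)

theorem Reduces.coe_σ {ρ : IsometricRep P g H} {K : ClosedSubmodule ℂ H} (hK : ρ.Reduces K)
    (a : A) (h : K.toSubmodule) : (compress K (ρ.σ a) h : H) = ρ.σ a h :=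
  coe_compress (hK.invariant.σ_mem _ _ h.2)

theorem Reduces.coe_T {ρ : IsometricRep P g H} {K : ClosedSubmodule ℂ H} (hK : ρ.Reduces K)
    (i : ι) (ξ : X (g i)) (h : K.toSubmodule) : (compress K (ρ.T i ξ) h : H) = ρ.T i ξ h :=
  coe_compress (hK.invariant.T_mem _ _ _ h.2)

theorem Reduces.coe_TT {ρ : IsometricRep P g H} {K : ClosedSubmodule ℂ H} (hK : ρ.Reduces K)
    (i j : ι) (ξ : X (g i)) (η : X (g j)) (h : K.toSubmodule) :
    (compress K (ρ.T i ξ ∘L ρ.T j η) h : H) = ρ.T i ξ (ρ.T j η h) :=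
  coe_compress (hK.invariant.T_mem _ _ _ (hK.invariant.T_mem _ _ _ h.2))

/-- The summand `ρ|_K` of `ρ` given by restriction to a reducing subspace `K`. -/
def restrict (ρ : IsometricRep P g H) {K : ClosedSubmodule ℂ H} (hK : ρ.Reduces K) :
    IsometricRep P g K.toSubmodule where
  σ :=
    { toFun := fun a => compress K (ρ.σ a)
      map_smul' := fun c a => by simp
      map_zero' := by simp
      map_add' := fun a b => by simp
      map_mul' := fun a b => by
        ext h
        rw [mul_apply_eq_comp, hK.coe_σ, hK.coe_σ, hK.coe_σ, map_mul]
        rfl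
      map_star' := fun a => by
        rw [ContinuousLinearMap.star_eq_adjoint, ContinuousLinearMap.eq_adjoint_iff]
        intro x y
        rw [Submodule.coe_inner, Submodule.coe_inner, hK.coe_σ, hK.coe_σ, map_star, ContinuousLinearMap.star_eq_adjoint,
          ContinuousLinearMap.adjoint_inner_left] }
  nondegenerate := by
    rw [IsNondegenerate, Submodule.topologicalClosure_eq_top_iff, eq_bot_iff]
    intro k hk
    have h0 : (k : H) ∈ (Submodule.span ℂ {z : H | ∃ a h, z = ρ.σ a h})ᗮ := by
      rw [Submodule.mem_orthogonal]
      intro u hu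
      induction hu using Submodule.span_induction with
      | zero => simp
      | add x y _ _ hx hy => rw [inner_add_left, hx, hy, add_zero]
      | smul c x _ hx => rw [inner_smul_left, hx, mul_zero]
      | mem x hx =>
        obtain ⟨a, h, rfl⟩ := hx
        obtain ⟨y, hy, z, hz, rfl⟩ := K.toSubmodule.exists_add_mem_mem_orthogonal h
        rw [map_add, inner_add_left, Submodule.inner_left_of_mem_orthogonal k.2
          (hK.invariant_orthogonal.σ_mem a z hz), add_zero]
        have := (Submodule.mem_orthogonal _ _).mp hk _ (Submodule.subset_span ⟨a, ⟨y, hy⟩, rfl⟩)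
        change ⟪compress K (ρ.σ a) ⟨y, hy⟩, k⟫_ℂ = 0 at this
        rwa [Submodule.coe_inner, hK.coe_σ] at this
    have h1 := ρ.nondegenerate
    rw [IsNondegenerate, Submodule.topologicalClosure_eq_top_iff] at h1
    rw [h1] at h0
    exact Subtype.ext h0
  T i := (compress K).toLinearMap ∘ₗ ρ.T i
  T_lsmul i a ξ := by
    ext h
    change (compress K _ h : H) = compress K (ρ.σ a) (compress K (ρ.T i ξ) h)
    rw [hK.coe_σ, hK.coe_T, hK.coe_T, ρ.T_lsmul]
    rfl
  T_rsmul i a ξ := by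
    ext h
    change (compress K _ h : H) = compress K (ρ.T i ξ) (compress K (ρ.σ a) h)
    rw [hK.coe_T, hK.coe_T, hK.coe_σ, ρ.T_rsmul]
    rfl
  isometric i ξ η := by
    ext1 h
    refine ext_inner_left ℂ fun w => ?_
    rw [ContinuousLinearMap.comp_apply, ContinuousLinearMap.adjoint_inner_right]
    change ⟪compress K (ρ.T i ξ) w, compress K (ρ.T i η) h⟫_ℂ = ⟪w, compress K (ρ.σ _) h⟫_ℂ
    rw [Submodule.coe_inner, Submodule.coe_inner, hK.coe_T, hK.coe_T, hK.coe_σ,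
      ← ρ.isometric i, ContinuousLinearMap.comp_apply, ContinuousLinearMap.adjoint_inner_right]
  commute i j := by
    obtain ⟨S, h1, h2⟩ := ρ.commute i j
    refine ⟨compress K ∘L S, fun ξ η => ?_, fun ξ η => ?_⟩
    · ext h
      change (compress K (S _) h : H) = compress K (ρ.T i ξ) (compress K (ρ.T j η) h)
      rw [h1, hK.coe_TT, hK.coe_T, hK.coe_T]
    · ext h
      change (compress K (S _) h : H) = compress K (ρ.T j η) (compress K (ρ.T i ξ) h)
      rw [h2, hK.coe_TT, hK.coe_T, hK.coe_T]

end IsometricRep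
end induced

section main

variable {k : ℕ} {A : Type*} {X : (Fin k → ℕ) → Type*} [NonUnitalCStarAlgebra A] [PartialOrder A]
  [StarOrderedRing A] [∀ m, NormedAddCommGroup (X m)]
  [∀ m, NormedSpace ℂ (X m)] [∀ m, Correspondence A (X m)]

/-- The `i`-th basis element of `ℕ^k`. -/
def basisDeg (i : Fin k) : Fin k → ℕ := Pi.single i 1

/-- The submonoid of `ℕ^k` of all `m` with `m i = 0` for `i ∉ α`; it is a copy of `ℕ^r`, `r = |α|`. -/
def supportedIn (α : Set (Fin k)) : AddSubmonoid (Fin k → ℕ) where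
  carrier := {m | ∀ i, i ∉ α → m i = 0}
  zero_mem' _ _ := rfl
  add_mem' hm hn i hi := by rw [Pi.add_apply, hm i hi, hn i hi]

/-- The basis elements of the submonoid `supportedIn α`. -/
def basisDegIn (α : Set (Fin k)) (i : α) : supportedIn α :=
  ⟨basisDeg i, fun j hj => Pi.single_eq_of_ne (fun e : j = (i : Fin k) => hj (by rw [e]; exact i.2)) 1⟩

/-- The representation `(σ, (T_i)_{i ∈ α})` of the product subsystem `E_α` given by the
correspondences `E_i`, `i ∈ α`. -/
def IsometricRep.coordPart {P : ProductSystem A X} {H : Type*} [NormedAddCommGroup H]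
    [InnerProductSpace ℂ H] [CompleteSpace H] (ρ : IsometricRep P basisDeg H) (α : Set (Fin k)) :
    IsometricRep (P.restrict (supportedIn α)) (basisDegIn α) H where
  σ := ρ.σ
  nondegenerate := ρ.nondegenerate
  T i := ρ.T i
  T_lsmul i := ρ.T_lsmul i
  T_rsmul i := ρ.T_rsmul i
  isometric i := ρ.isometric i
  commute i j := ρ.commute i j

/-- The conditions on a closed subspace `K`: it reduces `ρ`, the representation
`(σ, (T_i)_{i ∈ α})|_K` of the subsystem `E_α` is isomorphic to an induced representation, and
`(σ, T_i)|_K` is fully coisometric for every `i ∉ α`. -/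
structure IsometricRep.IsInducedCoisometricOn {P : ProductSystem A X} {H : Type*} [NormedAddCommGroup H]
    [InnerProductSpace ℂ H] [CompleteSpace H] (ρ : IsometricRep P basisDeg H) (α : Set (Fin k))
    (K : ClosedSubmodule ℂ H) : Prop where
  reduces : ρ.Reduces K
  induced : ((ρ.restrict reduces).coordPart α).IsInduced
  coisometric : ∀ i, i ∉ α → (ρ.restrict reduces).IsFullyCoisometric i

end main
end CorrProd

end

/-!
The properties in question pass to arbitrary closed linear spans, so the closed span of all closed
subspaces that have them is the largest such subspace. For reducing subspaces this is immediate.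
For full coisometry it follows from `isFullyCoisometric_restrict_iff`: as `T̃_i` is an isometry, the
condition on `K` says that `K` lies in the closed span of `T_i(ξ) K`.

The core is `isInducedOn_sSup`, for which no double commutation is required. Let `K_λ` be reducing
subspaces on which the representation is induced, with wandering subspaces `W_λ`, and let `W` be the
closed span of the `W_λ`. For each degree `n` there is an isometric map `S_n : X n → B(H)` that acts
on every `K_λ` as creation (`exists_isFibreMap`). The spaces `S_n(X n) W` span the join of the `K_λ`,
since `S_n(X n) W_λ` span `K_λ`. For `n = m`, the inner products of vectors `S_n(ξ) w` and
`S_m(η) w'` are those of the induced representation because `S_n` is isometric. For `n ≠ m`, one of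
the two degrees is not below the other, say `m` is not below `n`. If `w` lies in `W_λ`, then
`S_m(η)* S_n(ξ) w = 0`: this vector stays in the reducing subspace `K_λ`, and the identity
holds in the Fock space (`IsWanderingIn.adjoint_apply_eq_zero`). The condition involves one vector
of `W` only, so it extends from the `W_λ` to `W` by linearity and continuity. Thus
`ξ ⊗ w ↦ S_n(ξ) w` is an isometry of the Fock space over `W` onto the join.
-/

noncomputable section

namespace CorrProd

open PreHilbertModule Correspondence
open ContinuousLinearMap (adjoint)

/-! ### Isometric maps on a correspondence -/

section isometric

variable {A E H : Type*} [NonUnitalCStarAlgebra A] [PartialOrder A] [StarOrderedRing A]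
  [NormedAddCommGroup E] [NormedSpace ℂ E] [Correspondence A E]
  [NormedAddCommGroup H] [InnerProductSpace ℂ H] [CompleteSpace H]

theorem norm_tmul_le (π : A →⋆ₙₐ[ℂ] (H →L[ℂ] H)) (x : E) (h : H) :
    ‖tmul π x h‖ ≤ ‖h‖ * ‖x‖ := by
  have h1 := norm_sq_eq_re_inner (𝕜 := ℂ) (tmul π x h)
  rw [inner_tmul] at h1
  have h2 : ‖⟪h, π (ip x x) h⟫_ℂ‖ ≤ ‖h‖ * (‖x‖ ^ 2 * ‖h‖) := by
    refine (norm_inner_le_norm _ _).trans ?_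
    gcongr
    refine (ContinuousLinearMap.le_opNorm _ _).trans ?_
    gcongr
    rw [norm_sq (A := A)]
    exact NonUnitalStarAlgHom.norm_apply_le π _
  have h3 := RCLike.re_le_norm (⟪h, π (ip x x) h⟫_ℂ)
  refine abs_le_of_sq_le_sq' ?_ (by positivity) |>.2
  rw [h1]; nlinarith

theorem continuous_tmul (π : A →⋆ₙₐ[ℂ] (H →L[ℂ] H)) (h : H) :
    Continuous fun x : E => tmul π x h :=
  (LinearMap.mkContinuous
    ({ toFun := fun x => tmul π x h
       map_add' := fun x y => tmul_add_left π x y h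
       map_smul' := fun c x => tmul_smul_left π c x h } : E →ₗ[ℂ] InteriorTensor E π)
    ‖h‖ fun x => norm_tmul_le π x h).continuous

theorem opNorm_le_of_isometric {σ : A →⋆ₙₐ[ℂ] (H →L[ℂ] H)} {S : E → H →L[ℂ] H} {ξ : E}
    (hS : adjoint (S ξ) ∘L S ξ = σ (ip ξ ξ)) : ‖S ξ‖ ≤ ‖ξ‖ := by
  refine abs_le_of_sq_le_sq' ?_ (norm_nonneg _) |>.2
  rw [sq, ← ContinuousLinearMap.norm_adjoint_comp_self, hS, norm_sq (A := A)]
  exact NonUnitalStarAlgHom.norm_apply_le σ _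

end isometric

section fibre

variable {A M ι : Type*} {X : M → Type*} [NonUnitalCStarAlgebra A] [PartialOrder A]
  [StarOrderedRing A] [AddCommMonoid M] [∀ m, NormedAddCommGroup (X m)]
  [∀ m, NormedSpace ℂ (X m)] [∀ m, Correspondence A (X m)]

/-! ### Extending a representation to all fibres -/

theorem ProductSystem.denseRange_lift_mul (P : ProductSystem A X) {m n p : M} (h : m + n = p) :
    DenseRange (TensorProduct.lift (P.mul h)) := by
  have h1 : (Submodule.span ℂ {z : X p | ∃ x y, z = P.mul h x y}) ≤
      LinearMap.range (TensorProduct.lift (P.mul h)) := by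
    rw [Submodule.span_le]
    rintro _ ⟨x, y, rfl⟩
    exact ⟨x ⊗ₜ y, rfl⟩
  have h2 := Submodule.topologicalClosure_mono h1
  rw [P.dense_mul, top_le_iff] at h2
  exact Submodule.dense_iff_topologicalClosure_eq_top.mpr h2

theorem ProductSystem.eqOn_mul (P : ProductSystem A X) {m n p : M} (h : m + n = p)
    {G : Type*} [NormedAddCommGroup G] [NormedSpace ℂ G] {f f' : X p →L[ℂ] G}
    (hf : ∀ x y, f (P.mul h x y) = f' (P.mul h x y)) : f = f' := by
  refine ContinuousLinearMap.coeFn_injective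
    ((P.denseRange_lift_mul h).equalizer f.continuous f'.continuous (funext fun u => ?_))
  exact congr($(TensorProduct.ext' (g := f.toLinearMap ∘ₗ TensorProduct.lift (P.mul h))
    (h := f'.toLinearMap ∘ₗ TensorProduct.lift (P.mul h)) hf) u)

/-- Isometric maps on `X m` and `X n` multiply to an isometric map on `X (m + n)`: the Gram
operators of `S(ξ) T(η)` are prescribed by the inner products of the `ξ η`, so
`ξ η ↦ S(ξ) T(η)` is well defined and contractive on the dense span of the products. -/
theorem ProductSystem.exists_isometric_mul (P : ProductSystem A X) {H : Type*}
    [NormedAddCommGroup H] [InnerProductSpace ℂ H] [CompleteSpace H]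
    (σ : A →⋆ₙₐ[ℂ] (H →L[ℂ] H)) {m n p : M} (h : m + n = p)
    (S : X m →ₗ[ℂ] (H →L[ℂ] H)) (T : X n →ₗ[ℂ] (H →L[ℂ] H))
    (hS : ∀ ξ η, adjoint (S ξ) ∘L S η = σ (ip ξ η))
    (hT : ∀ ξ η, adjoint (T ξ) ∘L T η = σ (ip ξ η))
    (hT_lsmul : ∀ a η, T (lsmul a η) = σ a ∘L T η) :
    ∃ R : X p →L[ℂ] (H →L[ℂ] H), (∀ ξ η, R (P.mul h ξ η) = S ξ ∘L T η) ∧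
      ∀ ξ η, adjoint (R ξ) ∘L R η = σ (ip ξ η) := by
  let e : X m ⊗[ℂ] X n →ₗ[ℂ] X p := TensorProduct.lift (P.mul h)
  let f : X m ⊗[ℂ] X n →ₗ[ℂ] (H →L[ℂ] H) := TensorProduct.lift
    (LinearMap.mk₂ ℂ (fun ξ η => S ξ ∘L T η)
      (by intros; simp) (by intros; simp) (by intros; simp) (by intros; simp))
  have he : DenseRange e := P.denseRange_lift_mul h
  have hf : ∀ u v, adjoint (f u) ∘L f v = σ (ip (e u) (e v)) := by
    intro u v
    induction u with
    | zero => simp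
    | add u u' hu hu' =>
      simp only [map_add, ContinuousLinearMap.add_comp, LinearMap.add_apply, hu, hu']
    | tmul x y =>
      induction v with
      | zero => simp
      | add v v' hv hv' => simp only [map_add, ContinuousLinearMap.comp_add, hv, hv']
      | tmul x' y' =>
        change adjoint (S x ∘L T y) ∘L (S x' ∘L T y') = σ (ip (P.mul h x y) (P.mul h x' y'))
        rw [P.ip_mul, ← hT, hT_lsmul, ← hS, ContinuousLinearMap.adjoint_comp]
        rfl
  have hle : ∀ u, ‖f u‖ ≤ 1 * ‖e u‖ := by
    intro u
    rw [_root_.one_mul]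
    refine abs_le_of_sq_le_sq' ?_ (norm_nonneg _) |>.2
    rw [sq, ← ContinuousLinearMap.norm_adjoint_comp_self, hf, norm_sq (A := A)]
    exact NonUnitalStarAlgHom.norm_apply_le σ _
  have hR : ∀ u, f.extendOfNorm e (e u) = f u := LinearMap.extendOfNorm_eq he ⟨1, hle⟩
  refine ⟨f.extendOfNorm e, fun ξ η => hR (ξ ⊗ₜ η), fun ξ η => ?_⟩
  ext1 k
  refine ext_inner_left ℂ fun l => ?_
  rw [ContinuousLinearMap.comp_apply, ContinuousLinearMap.adjoint_inner_right, ← inner_tmul]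
  refine he.induction_on₂ (p := fun ξ η => ⟪f.extendOfNorm e ξ l, f.extendOfNorm e η k⟫_ℂ =
    ⟪tmul σ ξ l, tmul σ η k⟫_ℂ) ?_ (fun u v => ?_) ξ η
  · have c := continuous_tmul (E := X p) σ
    exact isClosed_eq (by fun_prop)
      (((c l).comp continuous_fst).inner ((c k).comp continuous_snd))
  · rw [hR, hR, inner_tmul, ← hf, ContinuousLinearMap.comp_apply,
      ContinuousLinearMap.adjoint_inner_right]

variable [IsCancelAdd M]

theorem fockCreationL_one {K : Type*} [NormedAddCommGroup K] [InnerProductSpace ℂ K]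
    [CompleteSpace K] (π : A →⋆ₙₐ[ℂ] (K →L[ℂ] K)) (P : ProductSystem A X) (a : A) :
    fockCreationL π P 0 (P.one a) = fockSigma π a := by
  classical
  refine InteriorTensor.ext π fun x h => ?_
  rw [fockCreationL_tmul, fockSigma_tmul]
  congr 1
  induction x using dfinsupp_induction with
  | zero => simp
  | add f g hf hg => simp only [map_add, hf, hg]
  | single i x =>
    rw [P.creation_single, ← P.single_mul (zero_add i), P.one_mul, fockLsmul_single]

theorem fockCreationL_mul {K : Type*} [NormedAddCommGroup K] [InnerProductSpace ℂ K]
    [CompleteSpace K] (π : A →⋆ₙₐ[ℂ] (K →L[ℂ] K)) (P : ProductSystem A X) {m n p : M}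
    (h : m + n = p) (ξ : X m) (η : X n) :
    fockCreationL π P p (P.mul h ξ η) = fockCreationL π P m ξ ∘L fockCreationL π P n η := by
  refine InteriorTensor.ext π fun x k => ?_
  rw [ContinuousLinearMap.comp_apply, fockCreationL_tmul, fockCreationL_tmul, fockCreationL_tmul,
    P.creation_mul]

namespace IsometricRep

universe v

variable {P : ProductSystem A X} {g : ι → M} {H : Type v} [NormedAddCommGroup H]
  [InnerProductSpace ℂ H] [CompleteSpace H]

/-- A bounded operator from a Fock space to `H` that intertwines the induced representation
with `ρ`. -/
structure IsFockIntertwiner (ρ : IsometricRep P g H) {K : Type*} [NormedAddCommGroup K]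
    [InnerProductSpace ℂ K] [CompleteSpace K] (π : A →⋆ₙₐ[ℂ] (K →L[ℂ] K))
    (V : FockSpace X π →L[ℂ] H) : Prop where
  sigma : ∀ a f, V (fockSigma π a f) = ρ.σ a (V f)
  creation : ∀ i ξ f, V (fockCreationL π P (g i) ξ f) = ρ.T i ξ (V f)

/-- `S` is a candidate for the map `T_n : X n → B(H)` that `ρ` determines on the fibre over `n`. It
is characterized only up to its behaviour on subspaces on which `ρ` is induced: there it is the
creation operator. This is all that is needed, and it is independent of the order in which the
`T_i` are multiplied to obtain `S`. -/
structure IsFibreMap (ρ : IsometricRep P g H) (n : M) (S : X n →L[ℂ] (H →L[ℂ] H)) : Prop where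
  isometric : ∀ ξ η, adjoint (S ξ) ∘L S η = ρ.σ (ip ξ η)
  mem : ∀ L : Submodule ℂ H, IsClosed (L : Set H) → ρ.Invariant L → ∀ ξ, ∀ h ∈ L, S ξ h ∈ L
  intertwine : ∀ {K : Type v} [NormedAddCommGroup K] [InnerProductSpace ℂ K] [CompleteSpace K]
    (π : A →⋆ₙₐ[ℂ] (K →L[ℂ] K)) (V : FockSpace X π →L[ℂ] H), ρ.IsFockIntertwiner π V →
    ∀ ξ f, S ξ (V f) = V (fockCreationL π P n ξ f)

theorem exists_isFibreMap_zero (ρ : IsometricRep P g H) : ∃ S, ρ.IsFibreMap 0 S := by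
  have hiso : ∀ ξ η : X 0, adjoint (ρ.σ (P.one.symm ξ)) ∘L ρ.σ (P.one.symm η) =
      ρ.σ (ip ξ η) := fun ξ η => by
    conv_rhs => rw [← P.one.apply_symm_apply ξ, ← P.one.apply_symm_apply η, P.ip_one, map_mul,
      map_star]
    rfl
  refine ⟨LinearMap.mkContinuous
    { toFun := fun ξ => ρ.σ (P.one.symm ξ)
      map_add' := by simp
      map_smul' := by simp } 1 fun ξ => ?_, hiso, fun L _ hL ξ h hh => hL.σ_mem _ _ hh,
    fun π V hV ξ f => ?_⟩
  · rw [_root_.one_mul]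
    exact opNorm_le_of_isometric (S := fun ξ => ρ.σ (P.one.symm ξ)) (hiso ξ ξ)
  · obtain ⟨a, rfl⟩ := P.one.surjective ξ
    rw [fockCreationL_one, hV.sigma]
    change ρ.σ (P.one.symm (P.one a)) (V f) = _
    rw [P.one.symm_apply_apply]

theorem IsFibreMap.exists_add {ρ : IsometricRep P g H} {n : M} {S : X n →L[ℂ] (H →L[ℂ] H)}
    (hS : ρ.IsFibreMap n S) (i : ι) : ∃ R, ρ.IsFibreMap (n + g i) R := by
  obtain ⟨R, hR, hiso⟩ := P.exists_isometric_mul ρ.σ (rfl : n + g i = _) S.toLinearMap (ρ.T i)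
    hS.isometric (ρ.isometric i) (ρ.T_lsmul i)
  refine ⟨R, hiso, fun L hL hinv ξ h hh => ?_, fun π V hV ξ f => ?_⟩
  · refine (P.denseRange_lift_mul (rfl : n + g i = _)).induction_on
      (p := fun ξ => R ξ h ∈ L) ξ (hL.preimage (by fun_prop)) fun u => ?_
    induction u with
    | zero => simp
    | add u u' hu hu' => simpa using L.add_mem hu hu'
    | tmul x y =>
      rw [TensorProduct.lift.tmul, hR]
      exact hS.mem L hL hinv _ _ (hinv.T_mem _ _ _ hh)
  · have := P.eqOn_mul (rfl : n + g i = _)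
      (f := (ContinuousLinearMap.apply ℂ H (V f)) ∘L R)
      (f' := V ∘L (ContinuousLinearMap.apply ℂ (FockSpace X π) f) ∘L
        fockCreationL π P (n + g i)) fun x y => by
        change R (P.mul rfl x y) (V f) = V (fockCreationL π P (n + g i) (P.mul rfl x y) f)
        rw [hR, fockCreationL_mul]
        change S x (ρ.T i y (V f)) = V (fockCreationL π P n x (fockCreationL π P (g i) y f))
        rw [← hV.creation, hS.intertwine π V hV]
    exact congr($this ξ)

theorem exists_isFibreMap (ρ : IsometricRep P g H)
    (hg : AddSubmonoid.closure (Set.range g) = ⊤) (n : M) : ∃ S, ρ.IsFibreMap n S := by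
  have hn : n ∈ AddSubmonoid.closure (Set.range g) := hg ▸ AddSubmonoid.mem_top n
  induction hn using AddSubmonoid.closure_induction_right with
  | zero => exact ρ.exists_isFibreMap_zero
  | add_right x _ y hy ih =>
    obtain ⟨i, rfl⟩ := hy
    obtain ⟨S, hS⟩ := ih
    exact hS.exists_add i

end IsometricRep

end fibre

/-! ### Isometries from interior tensor products and invariant subspaces of `A` -/

section aux

variable {A E K G : Type*} [NonUnitalCStarAlgebra A] [PartialOrder A] [StarOrderedRing A]
  [AddCommGroup E] [Module ℂ E] [PreHilbertModule A E]
  [NormedAddCommGroup K] [InnerProductSpace ℂ K] [CompleteSpace K]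
  [NormedAddCommGroup G] [InnerProductSpace ℂ G] [CompleteSpace G]

theorem exists_linearIsometry_tmul (π : A →⋆ₙₐ[ℂ] (K →L[ℂ] K)) (T : E →ₗ[ℂ] (K →L[ℂ] G))
    (hT : ∀ x y k l, ⟪T x k, T y l⟫_ℂ = ⟪k, π (ip x y) l⟫_ℂ) :
    ∃ V : InteriorTensor E π →ₗᵢ[ℂ] G, ∀ x k, V (tmul π x k) = T x k := by
  let f : AlgTensor E π →ₗ[ℂ] G :=
    TensorProduct.lift ((ContinuousLinearMap.coeLM ℂ).comp T) ∘ₗ (AlgTensor.mk π).symm.toLinearMap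
  have hf : ∀ v w, ⟪f v, f w⟫_ℂ = ⟪v, w⟫_ℂ := by
    intro v w
    induction v using AlgTensor.induction with
    | zero => simp
    | add v v' h h' => simp only [map_add, inner_add_left, h, h']
    | mk x h =>
      induction w using AlgTensor.induction with
      | zero => simp
      | add v v' h h' => simp only [map_add, inner_add_right, h, h']
      | mk y k =>
        rw [AlgTensor.inner_mk, ← hT]
        rfl
  have hn : ∀ v, ‖f v‖ = ‖v‖ := fun v => by
    rw [@norm_eq_sqrt_re_inner ℂ, hf, ← @norm_eq_sqrt_re_inner ℂ]
  let V := InteriorTensor.lift π (f.mkContinuous 1 fun v => by rw [hn, _root_.one_mul])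
  have hV : ∀ v : AlgTensor E π, V v = f v := InteriorTensor.lift_coe π _
  refine ⟨⟨V.toLinearMap, fun v => ?_⟩, fun x k => hV _⟩
  change ‖V v‖ = ‖v‖
  induction v using UniformSpace.Completion.induction_on with
  | hp => exact isClosed_eq V.continuous.norm continuous_norm
  | ih v => rw [hV, hn, UniformSpace.Completion.norm_coe]

/-- The restriction of a representation of `A` to an invariant complete subspace. -/
def restrictInvariant (σ : A →⋆ₙₐ[ℂ] (G →L[ℂ] G)) (W : Submodule ℂ G) [CompleteSpace W]
    (hW : ∀ a, ∀ h ∈ W, σ a h ∈ W) : A →⋆ₙₐ[ℂ] (W →L[ℂ] W) where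
  toFun a := (σ a ∘L W.subtypeL).codRestrict W fun h => hW a h h.2
  map_smul' c a := by ext; simp; rfl
  map_zero' := by ext; simp
  map_add' a b := by ext; simp; rfl
  map_mul' a b := by ext; simp; rfl
  map_star' a := by
    rw [ContinuousLinearMap.star_eq_adjoint, ContinuousLinearMap.eq_adjoint_iff]
    intro x y
    change ⟪σ (star a) x, (y : G)⟫_ℂ = ⟪(x : G), σ a y⟫_ℂ
    rw [map_star, ContinuousLinearMap.star_eq_adjoint, ContinuousLinearMap.adjoint_inner_left]

theorem coe_restrictInvariant (σ : A →⋆ₙₐ[ℂ] (G →L[ℂ] G)) (W : Submodule ℂ G) [CompleteSpace W]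
    (hW : ∀ a, ∀ h ∈ W, σ a h ∈ W) (a : A) (w : W) :
    (restrictInvariant σ W hW a w : G) = σ a w := rfl

theorem IsNondegenerate.restrictInvariant {σ : A →⋆ₙₐ[ℂ] (G →L[ℂ] G)} (hσ : IsNondegenerate σ)
    (W : Submodule ℂ G) [CompleteSpace W] (hW : ∀ a, ∀ h ∈ W, σ a h ∈ W) :
    IsNondegenerate (restrictInvariant σ W hW) := by
  rw [IsNondegenerate, Submodule.topologicalClosure_eq_top_iff] at hσ ⊢
  rw [eq_bot_iff]
  intro w hw
  have h0 : ∀ a, σ (star a) w = 0 := fun a => by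
    have h1 := (Submodule.mem_orthogonal _ _).mp hw _
      (Submodule.subset_span ⟨a, ⟨_, hW (star a) w w.2⟩, rfl⟩)
    rw [Submodule.coe_inner, coe_restrictInvariant, ← ContinuousLinearMap.adjoint_inner_right,
      ← ContinuousLinearMap.star_eq_adjoint, ← map_star] at h1
    exact inner_self_eq_zero.mp h1
  have h2 : (w : G) ∈ (Submodule.span ℂ {z : G | ∃ a h, z = σ a h})ᗮ := by
    rw [Submodule.mem_orthogonal]
    intro u hu
    induction hu using Submodule.span_induction with
    | zero => simp
    | add x y _ _ hx hy => rw [inner_add_left, hx, hy, add_zero]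
    | smul c x _ hx => rw [inner_smul_left, hx, mul_zero]
    | mem x hx =>
      obtain ⟨a, h, rfl⟩ := hx
      rw [← ContinuousLinearMap.adjoint_inner_right, ← ContinuousLinearMap.star_eq_adjoint,
        ← map_star, h0, inner_zero_right]
  rw [hσ] at h2
  exact Subtype.ext h2

end aux

namespace IsometricRep

universe v

section wandering

variable {A M ι : Type*} {X : M → Type*} [NonUnitalCStarAlgebra A] [PartialOrder A]
  [StarOrderedRing A] [AddCommMonoid M] [IsCancelAdd M] [∀ m, NormedAddCommGroup (X m)]
  [∀ m, NormedSpace ℂ (X m)] [∀ m, Correspondence A (X m)]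
  {P : ProductSystem A X} {g : ι → M} {H : Type v} [NormedAddCommGroup H]
  [InnerProductSpace ℂ H] [CompleteSpace H]

/-! ### Wandering vectors of induced summands -/

/-- `L` is the range of an isometry of a Fock space into `H` that intertwines the
induced representation with `ρ`; so the restriction of `ρ` to `L` is induced. -/
def IsInducedOn (ρ : IsometricRep P g H) (L : Submodule ℂ H) : Prop :=
  ∃ (K : Type v) (_ : NormedAddCommGroup K) (_ : InnerProductSpace ℂ K) (_ : CompleteSpace K)
    (π : A →⋆ₙₐ[ℂ] (K →L[ℂ] K)) (V : FockSpace X π →ₗᵢ[ℂ] H), IsNondegenerate π ∧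
    ρ.IsFockIntertwiner π V.toContinuousLinearMap ∧ LinearMap.range V.toLinearMap = L

open scoped Classical in
/-- `w` is the image of an elementary tensor of degree `0` for some identification of `L` with a
Fock space. -/
def IsWanderingIn (ρ : IsometricRep P g H) (L : Submodule ℂ H) (w : H) : Prop :=
  ∃ (K : Type v) (_ : NormedAddCommGroup K) (_ : InnerProductSpace ℂ K) (_ : CompleteSpace K)
    (π : A →⋆ₙₐ[ℂ] (K →L[ℂ] K)) (V : FockSpace X π →ₗᵢ[ℂ] H),
    ρ.IsFockIntertwiner π V.toContinuousLinearMap ∧ LinearMap.range V.toLinearMap = L ∧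
    ∃ (x : X 0) (k : K), w = V (tmul π (DFinsupp.single 0 x) k)

variable {ρ : IsometricRep P g H} {L : Submodule ℂ H} {w : H}

theorem IsWanderingIn.mem (hw : ρ.IsWanderingIn L w) : w ∈ L := by
  obtain ⟨K, _, _, _, π, V, hV, rfl, x, k, rfl⟩ := hw
  exact ⟨_, rfl⟩

theorem IsWanderingIn.sigma (hw : ρ.IsWanderingIn L w) (a : A) :
    ρ.IsWanderingIn L (ρ.σ a w) := by
  classical
  obtain ⟨K, _, _, _, π, V, hV, hL, x, k, rfl⟩ := hw
  refine ⟨K, _, _, _, π, V, hV, hL, lsmul a x, k, ?_⟩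
  have := hV.sigma a (tmul π (DFinsupp.single 0 x) k)
  rw [fockSigma_tmul, fockLsmul_single] at this
  exact this.symm

theorem IsWanderingIn.apply_lsmul {n : M} {S : X n →L[ℂ] (H →L[ℂ] H)} (hS : ρ.IsFibreMap n S)
    (hw : ρ.IsWanderingIn L w) (a : A) (ξ : X n) : S (lsmul a ξ) w = ρ.σ a (S ξ w) := by
  classical
  obtain ⟨K, _, _, _, π, V, hV, hL, x, k, rfl⟩ := hw
  have h1 := hS.intertwine π _ hV (lsmul a ξ) (tmul π (DFinsupp.single 0 x) k)
  have h2 := hS.intertwine π _ hV ξ (tmul π (DFinsupp.single 0 x) k)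
  rw [fockCreationL_tmul, P.creation_lsmul, ← fockSigma_tmul, ← fockCreationL_tmul] at h1
  exact h1.trans ((hV.sigma a _).trans (congrArg (ρ.σ a) h2.symm))

theorem IsWanderingIn.T_comp {n p : M} {S : X n →L[ℂ] (H →L[ℂ] H)}
    {R : X p →L[ℂ] (H →L[ℂ] H)} (hS : ρ.IsFibreMap n S) (hR : ρ.IsFibreMap p R)
    (hw : ρ.IsWanderingIn L w) (i : ι) (h : g i + n = p) (ξ : X (g i)) (η : X n) :
    R (P.mul h ξ η) w = ρ.T i ξ (S η w) := by
  classical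
  obtain ⟨K, _, _, _, π, V, hV, hL, x, k, rfl⟩ := hw
  have h1 := hR.intertwine π _ hV (P.mul h ξ η) (tmul π (DFinsupp.single 0 x) k)
  have h2 := hS.intertwine π _ hV η (tmul π (DFinsupp.single 0 x) k)
  rw [fockCreationL_mul] at h1
  exact h1.trans ((hV.creation i ξ _).trans (congrArg (ρ.T i ξ) h2.symm))

/-- Vectors of degree `n` are annihilated by `S(η)*` for `η` of a degree `m` not below `n`. In the
Fock space this holds since a creation operator of degree `m` has no component of degree `n`, and
`S(η)*` maps the reducing subspace `L` into itself. -/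
theorem IsWanderingIn.adjoint_apply_eq_zero {m n : M} {S : X m →L[ℂ] (H →L[ℂ] H)}
    {R : X n →L[ℂ] (H →L[ℂ] H)} (hS : ρ.IsFibreMap m S) (hR : ρ.IsFibreMap n R)
    (hmn : ∀ p, m + p ≠ n) (hL : ρ.Invariant Lᗮ) (hw : ρ.IsWanderingIn L w)
    (η : X m) (ξ : X n) : adjoint (S η) (R ξ w) = 0 := by
  classical
  obtain ⟨K, _, _, _, π, V, hV, rfl, x, k, rfl⟩ := hw
  have hR' : R ξ (V (tmul π (DFinsupp.single 0 x) k)) =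
      V (tmul π (DFinsupp.single (n + 0) (P.mul rfl ξ x)) k) := by
    have := hR.intertwine π _ hV ξ (tmul π (DFinsupp.single 0 x) k)
    rwa [fockCreationL_tmul, P.creation_single] at this
  rw [hR']
  have hcl : IsClosed (LinearMap.range V.toLinearMap : Set H) :=
    V.isometry.isClosedEmbedding.isClosed_range
  have hz : adjoint (V.toContinuousLinearMap ∘L fockCreationL π P m η)
      (V (tmul π (DFinsupp.single (n + 0) (P.mul rfl ξ x)) k)) = 0 := by
    have : innerSL ℂ (V (tmul π (DFinsupp.single (n + 0) (P.mul rfl ξ x)) k)) ∘L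
        (V.toContinuousLinearMap ∘L fockCreationL π P m η) = 0 := by
      refine InteriorTensor.ext π fun y l => ?_
      change ⟪V _, V (fockCreationL π P m η (tmul π y l))⟫_ℂ = 0
      rw [V.inner_map_map, fockCreationL_tmul, inner_tmul]
      have h0 : ip (A := A) (DFinsupp.single (n + 0) (P.mul rfl ξ x) : Π₀ n, X n)
          (P.creation η y) = 0 := by
        induction y using dfinsupp_induction with
        | zero => simp
        | add f g hf hg => simp only [map_add, hf, hg, add_zero]
        | single i y =>
          rw [P.creation_single, dfinsupp_ip_single, DFinsupp.single_eq_of_ne]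
          · simp
          · rw [add_zero]; exact hmn i
      rw [h0, map_zero]
      simp
    refine ext_inner_right ℂ fun f => ?_
    rw [ContinuousLinearMap.adjoint_inner_left, inner_zero_left]
    exact congr($this f)
  set u := V (tmul π (DFinsupp.single (n + 0) (P.mul rfl ξ x)) k) with hu
  have h1 : adjoint (S η) u ∈ (LinearMap.range V.toLinearMap)ᗮ := by
    rw [Submodule.mem_orthogonal]
    rintro _ ⟨f, rfl⟩
    rw [ContinuousLinearMap.adjoint_inner_right]
    have h3 : S η (V.toLinearMap f) = (V.toContinuousLinearMap ∘L fockCreationL π P m η) f :=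
      hS.intertwine π _ hV η f
    rw [h3, ← ContinuousLinearMap.adjoint_inner_right, hz, inner_zero_right]
  have h2 : adjoint (S η) u ∈ (LinearMap.range V.toLinearMap)ᗮᗮ := by
    rw [Submodule.mem_orthogonal]
    intro z hz'
    rw [ContinuousLinearMap.adjoint_inner_right]
    refine Submodule.inner_left_of_mem_orthogonal (K := LinearMap.range V.toLinearMap) ⟨_, rfl⟩
      (hS.mem _ (Submodule.isClosed_orthogonal _) hL _ _ hz')
  have := (Submodule.mem_orthogonal _ _).mp h2 _ h1
  exact inner_self_eq_zero.mp this

/-- The wandering vectors generate an induced summand. -/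
theorem IsInducedOn.le_of_forall_wandering (hL : ρ.IsInducedOn L)
    {S : ∀ n, X n →L[ℂ] (H →L[ℂ] H)} (hS : ∀ n, ρ.IsFibreMap n (S n)) {C : Submodule ℂ H}
    (hC : IsClosed (C : Set H)) (h : ∀ w, ρ.IsWanderingIn L w → ∀ n ξ, S n ξ w ∈ C) : L ≤ C := by
  classical
  obtain ⟨K, _, _, _, π, V, -, hV, rfl⟩ := hL
  suffices ht : C.comap V.toLinearMap = ⊤ by
    rintro _ ⟨f, rfl⟩
    exact (ht ▸ Submodule.mem_top : f ∈ C.comap V.toLinearMap)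
  refine InteriorTensor.eq_top π (hC.preimage V.continuous) fun x k => ?_
  change V (tmul π x k) ∈ C
  induction x using dfinsupp_induction with
  | zero =>
    have := tmul_smul_left π 0 (0 : Π₀ m, X m) k
    rw [zero_smul, zero_smul] at this
    rw [this, map_zero]
    exact C.zero_mem
  | add x y hx hy => rw [tmul_add_left, map_add]; exact C.add_mem hx hy
  | single n x =>
    -- approximate `x : X n` by sums of products of elements of `X n` and `X 0`
    have hc : Continuous fun x : X n => V (tmul π (DFinsupp.single n x) k) :=
      V.continuous.comp (LinearMap.mkContinuous
        ({ toFun := fun x => tmul π (DFinsupp.single n x) k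
           map_add' := fun x y => by rw [DFinsupp.single_add, tmul_add_left]
           map_smul' := fun c x => by rw [DFinsupp.single_smul, tmul_smul_left, RingHom.id_apply] } :
          X n →ₗ[ℂ] FockSpace X π)
        ‖k‖ fun x => norm_tmul_single_le π n x k).continuous
    refine (P.denseRange_lift_mul (add_zero n)).induction_on
      (p := fun x => V (tmul π (DFinsupp.single n x) k) ∈ C) x (hC.preimage hc) fun u => ?_
    induction u with
    | zero =>
      have := tmul_smul_left π 0 (0 : Π₀ m, X m) k
      rw [zero_smul, zero_smul] at this
      rw [map_zero, DFinsupp.single_zero, this, map_zero]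
      exact C.zero_mem
    | add u u' hu hu' =>
      rw [map_add, DFinsupp.single_add, tmul_add_left, map_add]
      exact C.add_mem hu hu'
    | tmul y z =>
      have h1 := h _ ⟨K, _, _, _, π, V, hV, rfl, z, k, rfl⟩ n y
      have h2 := (hS n).intertwine π _ hV y (tmul π (DFinsupp.single 0 z) k)
      rw [fockCreationL_tmul, P.creation_single, ← P.single_mul (add_zero n)] at h2
      exact h2 ▸ h1

end wandering

/-! ### Joins of induced summands -/

section join

variable {A M ι : Type*} {X : M → Type*} [NonUnitalCStarAlgebra A] [PartialOrder A]
  [StarOrderedRing A] [AddCommMonoid M] [∀ m, NormedAddCommGroup (X m)]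
  [∀ m, NormedSpace ℂ (X m)] [∀ m, Correspondence A (X m)]
  {P : ProductSystem A X} {g : ι → M} {H : Type v} [NormedAddCommGroup H]
  [InnerProductSpace ℂ H] [CompleteSpace H] {ρ : IsometricRep P g H}

theorem apply_mem_sSup {𝒦 : Set (ClosedSubmodule ℂ H)} {S : H →L[ℂ] H}
    (hS : ∀ K ∈ 𝒦, ∀ h ∈ K.toSubmodule, S h ∈ K.toSubmodule) :
    ∀ h ∈ (sSup 𝒦).toSubmodule, S h ∈ (sSup 𝒦).toSubmodule := by
  have : sSup 𝒦 ≤ (sSup 𝒦).comap S :=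
    sSup_le fun K hK h hh => le_sSup hK (hS K hK h hh)
  exact fun h hh => this hh

theorem apply_mem_orthogonal_sSup {𝒦 : Set (ClosedSubmodule ℂ H)} {S : H →L[ℂ] H}
    (hS : ∀ K ∈ 𝒦, ∀ h ∈ K.toSubmoduleᗮ, S h ∈ K.toSubmoduleᗮ) :
    ∀ h ∈ (sSup 𝒦).toSubmoduleᗮ, S h ∈ (sSup 𝒦).toSubmoduleᗮ := by
  intro h hh
  have : sSup 𝒦 ≤ ⟨(ℂ ∙ S h)ᗮ, Submodule.isClosed_orthogonal _⟩ := sSup_le fun K hK u hu => by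
    refine (Submodule.mem_orthogonal_singleton_iff_inner_left).mpr ?_
    refine (Submodule.mem_orthogonal _ _).mp (hS K hK h ?_) u hu
    exact Submodule.orthogonal_le (le_sSup hK : K ≤ sSup 𝒦) hh
  rw [Submodule.mem_orthogonal]
  exact fun u hu => (Submodule.mem_orthogonal_singleton_iff_inner_left).mp (this hu)

theorem reduces_sSup {𝒦 : Set (ClosedSubmodule ℂ H)} (h : ∀ K ∈ 𝒦, ρ.Reduces K) :
    ρ.Reduces (sSup 𝒦) where
  invariant := ⟨fun a => apply_mem_sSup fun K hK => (h K hK).invariant.σ_mem a,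
    fun i ξ => apply_mem_sSup fun K hK => (h K hK).invariant.T_mem i ξ⟩
  invariant_orthogonal :=
    ⟨fun a => apply_mem_orthogonal_sSup fun K hK => (h K hK).invariant_orthogonal.σ_mem a,
      fun i ξ => apply_mem_orthogonal_sSup fun K hK => (h K hK).invariant_orthogonal.T_mem i ξ⟩

/-- The closed linear span of the wandering vectors of all members of `𝒦`. -/
def wanderingSpan [IsCancelAdd M] (ρ : IsometricRep P g H) (𝒦 : Set (ClosedSubmodule ℂ H)) :
    Submodule ℂ H :=
  (Submodule.span ℂ {w | ∃ K ∈ 𝒦, ρ.IsWanderingIn K.toSubmodule w}).topologicalClosure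

instance [IsCancelAdd M] (𝒦 : Set (ClosedSubmodule ℂ H)) :
    CompleteSpace (wanderingSpan ρ 𝒦) :=
  Submodule.topologicalClosure.completeSpace _

theorem wanderingSpan_le [IsCancelAdd M] {𝒦 : Set (ClosedSubmodule ℂ H)} {C : Submodule ℂ H}
    (hC : IsClosed (C : Set H))
    (h : ∀ K ∈ 𝒦, ∀ w, ρ.IsWanderingIn K.toSubmodule w → w ∈ C) : wanderingSpan ρ 𝒦 ≤ C :=
  Submodule.topologicalClosure_minimal _
    (Submodule.span_le.mpr fun w ⟨K, hK, hw⟩ => h K hK w hw) hC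

theorem eqOn_wanderingSpan [IsCancelAdd M] {𝒦 : Set (ClosedSubmodule ℂ H)} {S S' : H →L[ℂ] H}
    (h : ∀ K ∈ 𝒦, ∀ w, ρ.IsWanderingIn K.toSubmodule w → S w = S' w) {w : H}
    (hw : w ∈ wanderingSpan ρ 𝒦) : S w = S' w :=
  wanderingSpan_le (C := LinearMap.eqLocus S.toLinearMap S'.toLinearMap)
    (isClosed_eq S.continuous S'.continuous) h hw

/-- The join of reducing subspaces on which `ρ` is induced is again one. The candidate for the
wandering subspace is the closed span `W` of all wandering vectors. That vectors of different
degrees generated by `W` are orthogonal involves two members of the family, but follows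
from `IsWanderingIn.adjoint_apply_eq_zero`, which is about one of them. -/
theorem isInducedOn_sSup [IsCancelAdd M] (hg : AddSubmonoid.closure (Set.range g) = ⊤)
    (hM : ∀ p q : M, p + q = 0 → p = 0) {𝒦 : Set (ClosedSubmodule ℂ H)}
    (hred : ∀ K ∈ 𝒦, ρ.Reduces K) (hind : ∀ K ∈ 𝒦, ρ.IsInducedOn K.toSubmodule) :
    ρ.IsInducedOn (sSup 𝒦).toSubmodule := by
  classical
  choose S hS using ρ.exists_isFibreMap hg
  have hinv := (reduces_sSup hred).invariant
  have hW : ∀ a, ∀ w ∈ wanderingSpan ρ 𝒦, ρ.σ a w ∈ wanderingSpan ρ 𝒦 := fun a =>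
    wanderingSpan_le (C := (wanderingSpan ρ 𝒦).comap (ρ.σ a).toLinearMap)
      ((Submodule.isClosed_topologicalClosure _).preimage (ρ.σ a).continuous)
      fun K hK w hw => Submodule.le_topologicalClosure _ (Submodule.subset_span ⟨K, hK, hw.sigma a⟩)
  have hWle : wanderingSpan ρ 𝒦 ≤ (sSup 𝒦).toSubmodule :=
    wanderingSpan_le (sSup 𝒦).isClosed fun K hK w hw => le_sSup hK hw.mem
  have hzero : ∀ m n, (∀ p, m + p ≠ n) → ∀ (x : X m) (y : X n), ∀ w ∈ wanderingSpan ρ 𝒦,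
      adjoint (S m x) (S n y w) = 0 := fun m n hmn x y w hw =>
    eqOn_wanderingSpan (S := adjoint (S m x) ∘L S n y) (S' := 0)
      (fun K hK w hw => hw.adjoint_apply_eq_zero (hS m) (hS n) hmn
        (hred K hK).invariant_orthogonal x y) hw
  have horth : ∀ m n, m ≠ n → ∀ (x : X m) (y : X n), ∀ w ∈ wanderingSpan ρ 𝒦,
      ∀ w' ∈ wanderingSpan ρ 𝒦, ⟪S m x w, S n y w'⟫_ℂ = 0 := by
    intro m n hne x y w hw w' hw'
    by_cases hmn : ∀ p, m + p ≠ n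
    · rw [← ContinuousLinearMap.adjoint_inner_right, hzero m n hmn x y w' hw', inner_zero_right]
    · -- as `M` is cancellative without invertible elements, `m ≤ n ≤ m` would force `m = n`
      have hnm : ∀ q, n + q ≠ m := by
        rintro q rfl
        push Not at hmn
        obtain ⟨p, hp⟩ := hmn
        have : q + p = 0 := add_left_cancel (a := n) (by rw [← add_assoc, hp, add_zero])
        exact hne (by rw [hM q p this, add_zero])
      rw [← ContinuousLinearMap.adjoint_inner_left, hzero n m hnm y x w hw, inner_zero_left]
  let π := restrictInvariant ρ.σ (wanderingSpan ρ 𝒦) hW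
  let T : (Π₀ n, X n) →ₗ[ℂ] (wanderingSpan ρ 𝒦 →L[ℂ] H) := DFinsupp.lsum ℂ fun n =>
    ((ContinuousLinearMap.compL ℂ (wanderingSpan ρ 𝒦) H H).flip
      (wanderingSpan ρ 𝒦).subtypeL).toLinearMap ∘ₗ (S n).toLinearMap
  have hT : ∀ n (x : X n) (w : wanderingSpan ρ 𝒦), T (DFinsupp.single n x) w = S n x w :=
    fun n x w => DFunLike.congr_fun (DFinsupp.lsum_single ℂ _ n x) w
  obtain ⟨V, hV⟩ := exists_linearIsometry_tmul π T fun x y w w' => by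
    induction x using dfinsupp_induction with
    | zero => simp
    | add x x' hx hx' => simp only [map_add, add_apply, LinearMap.add_apply, inner_add_left,
        inner_add_right, hx, hx']
    | single m x =>
      induction y using dfinsupp_induction with
      | zero => simp
      | add x x' hx hx' => simp only [map_add, add_apply, inner_add_right, hx, hx']
      | single n y =>
        rw [hT, hT, dfinsupp_ip_single]
        by_cases hmn : m = n
        · subst hmn
          rw [DFinsupp.single_eq_same, ← ContinuousLinearMap.adjoint_inner_right,
            ← ContinuousLinearMap.comp_apply, (hS m).isometric]
          rfl
        · rw [horth m n hmn x y w w.2 w' w'.2, DFinsupp.single_eq_of_ne (Ne.symm hmn)]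
          simp
  have hsingle : ∀ n (x : X n) (w : wanderingSpan ρ 𝒦),
      V (tmul π (DFinsupp.single n x) w) = S n x w := fun n x w => by rw [hV, hT]
  have hclV : IsClosed (LinearMap.range V.toLinearMap : Set H) :=
    V.isometry.isClosedEmbedding.isClosed_range
  refine ⟨wanderingSpan ρ 𝒦, _, _, _, π, V, ρ.nondegenerate.restrictInvariant _ hW,
    ⟨fun a f => ?_, fun i ξ f => ?_⟩, le_antisymm ?_ ?_⟩
  · refine congr($(InteriorTensor.ext π (S := V.toContinuousLinearMap ∘L fockSigma π a)
      (S' := ρ.σ a ∘L V.toContinuousLinearMap) fun x w => ?_) f)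
    change V (fockSigma π a (tmul π x w)) = ρ.σ a (V (tmul π x w))
    rw [fockSigma_tmul, hV, hV]
    induction x using dfinsupp_induction with
    | zero => simp
    | add x x' hx hx' => simp only [map_add, add_apply, hx, hx']
    | single n x =>
      rw [fockLsmul_single, hT, hT]
      exact eqOn_wanderingSpan (S := S n (lsmul a x)) (S' := ρ.σ a ∘L S n x)
        (fun K hK w hw => hw.apply_lsmul (hS n) a x) w.2
  · refine congr($(InteriorTensor.ext π (S := V.toContinuousLinearMap ∘L fockCreationL π P (g i) ξ)
      (S' := ρ.T i ξ ∘L V.toContinuousLinearMap) fun x w => ?_) f)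
    change V (fockCreationL π P (g i) ξ (tmul π x w)) = ρ.T i ξ (V (tmul π x w))
    rw [fockCreationL_tmul, hV, hV]
    induction x using dfinsupp_induction with
    | zero => simp
    | add x x' hx hx' => simp only [map_add, add_apply, hx, hx']
    | single n x =>
      rw [P.creation_single, hT, hT]
      exact eqOn_wanderingSpan (S := S (g i + n) (P.mul rfl ξ x)) (S' := ρ.T i ξ ∘L S n x)
        (fun K hK w hw => hw.T_comp (hS n) (hS _) i rfl ξ x) w.2
  · suffices ht : (sSup 𝒦).toSubmodule.comap V.toLinearMap = ⊤ by
      rintro _ ⟨f, rfl⟩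
      exact (ht ▸ Submodule.mem_top : f ∈ (sSup 𝒦).toSubmodule.comap V.toLinearMap)
    refine InteriorTensor.eq_top π ((sSup 𝒦).isClosed.preimage V.continuous) fun x w => ?_
    change V (tmul π x w) ∈ (sSup 𝒦).toSubmodule
    rw [hV]
    induction x using dfinsupp_induction with
    | zero => simp
    | add x x' hx hx' => rw [map_add]; exact Submodule.add_mem _ hx hx'
    | single n x => rw [hT]; exact (hS n).mem _ (sSup 𝒦).isClosed hinv x _ (hWle w.2)
  · have : sSup 𝒦 ≤ ⟨LinearMap.range V.toLinearMap, hclV⟩ := sSup_le fun K hK =>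
      (hind K hK).le_of_forall_wandering hS hclV fun w hw n ξ =>
        ⟨_, hsingle n ξ ⟨w, Submodule.le_topologicalClosure _
          (Submodule.subset_span ⟨K, hK, hw⟩)⟩⟩
    exact this

end join

/-! ### Restrictions to reducing subspaces -/

section coisometric

variable {A M ι : Type*} {X : M → Type*} [NonUnitalCStarAlgebra A] [PartialOrder A]
  [StarOrderedRing A] [AddCommMonoid M] [∀ m, NormedAddCommGroup (X m)]
  [∀ m, NormedSpace ℂ (X m)] [∀ m, Correspondence A (X m)]
  {P : ProductSystem A X} {g : ι → M} {H : Type v} [NormedAddCommGroup H]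
  [InnerProductSpace ℂ H] [CompleteSpace H] {ρ : IsometricRep P g H}

theorem tildeT_tmul (ρ : IsometricRep P g H) (i : ι) (ξ : X (g i)) (h : H) :
    ρ.tildeT i (tmul ρ.σ ξ h) = ρ.T i ξ h :=
  tilde_tmul ..

theorem adjoint_tildeT_comp (ρ : IsometricRep P g H) (i : ι) :
    adjoint (ρ.tildeT i) ∘L ρ.tildeT i = ContinuousLinearMap.id ℂ _ :=
  InteriorTensor.adjoint_comp_eq ρ.σ fun x y h k => by
    rw [tildeT_tmul, tildeT_tmul, ContinuousLinearMap.id_apply, inner_tmul, ← ρ.isometric,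
      ContinuousLinearMap.comp_apply, ContinuousLinearMap.adjoint_inner_right]

/-- As `T̃_i` is an isometry, it is coisometric exactly if its range is dense. -/
theorem isFullyCoisometric_iff (ρ : IsometricRep P g H) (i : ι) :
    ρ.IsFullyCoisometric i ↔
      (Submodule.span ℂ {z | ∃ ξ h, z = ρ.T i ξ h}).topologicalClosure = ⊤ := by
  constructor
  · intro hc
    have ht := InteriorTensor.eq_top ρ.σ (W := (Submodule.span ℂ
      {z | ∃ ξ h, z = ρ.T i ξ h}).topologicalClosure.comap (ρ.tildeT i).toLinearMap)
      ((Submodule.isClosed_topologicalClosure _).preimage (ρ.tildeT i).continuous) fun x k =>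
        Submodule.le_topologicalClosure _ (Submodule.subset_span ⟨x, k, ρ.tildeT_tmul i x k⟩)
    rw [eq_top_iff]
    rintro h -
    have h1 : ρ.tildeT i (adjoint (ρ.tildeT i) h) = h := congr($hc h)
    rw [← h1]
    exact (ht ▸ Submodule.mem_top : adjoint (ρ.tildeT i) h ∈ Submodule.comap _ _)
  · intro ht
    have h1 := Submodule.topologicalClosure_minimal (Submodule.span ℂ {z | ∃ ξ h, z = ρ.T i ξ h})
      (t := LinearMap.eqLocus (ρ.tildeT i ∘L adjoint (ρ.tildeT i)).toLinearMap LinearMap.id)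
      (Submodule.span_le.mpr ?_)
      (isClosed_eq (ρ.tildeT i ∘L adjoint (ρ.tildeT i)).continuous continuous_id)
    · rw [ht] at h1
      ext h
      exact h1 (Submodule.mem_top (x := h))
    · rintro _ ⟨ξ, h, rfl⟩
      change ρ.tildeT i (adjoint (ρ.tildeT i) (ρ.T i ξ h)) = ρ.T i ξ h
      rw [← tildeT_tmul]
      exact congr(ρ.tildeT i ($(ρ.adjoint_tildeT_comp i) _))

theorem isFullyCoisometric_restrict_iff {K : ClosedSubmodule ℂ H} (hK : ρ.Reduces K) (i : ι) :
    (ρ.restrict hK).IsFullyCoisometric i ↔ K.toSubmodule ≤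
      (Submodule.span ℂ {z | ∃ ξ, ∃ h ∈ K.toSubmodule, z = ρ.T i ξ h}).topologicalClosure := by
  rw [isFullyCoisometric_iff, ← Submodule.dense_iff_topologicalClosure_eq_top]
  have himg : Submodule.map K.toSubmodule.subtype
      (Submodule.span ℂ {z | ∃ ξ h, z = (ρ.restrict hK).T i ξ h}) =
      Submodule.span ℂ {z | ∃ ξ, ∃ h ∈ K.toSubmodule, z = ρ.T i ξ h} := by
    rw [Submodule.map_span]
    congr 1
    ext z
    constructor
    · rintro ⟨_, ⟨ξ, h, rfl⟩, rfl⟩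
      exact ⟨ξ, h, h.2, hK.coe_T i ξ h⟩
    · rintro ⟨ξ, h, hh, rfl⟩
      exact ⟨_, ⟨ξ, ⟨h, hh⟩, rfl⟩, hK.coe_T i ξ ⟨h, hh⟩⟩
  rw [← himg, Subtype.dense_iff]
  rfl

theorem isFullyCoisometric_sSup {𝒦 : Set (ClosedSubmodule ℂ H)} {i : ι}
    (h : ∀ K ∈ 𝒦, ∃ hK : ρ.Reduces K, (ρ.restrict hK).IsFullyCoisometric i)
    (hred : ρ.Reduces (sSup 𝒦)) : (ρ.restrict hred).IsFullyCoisometric i := by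
  rw [isFullyCoisometric_restrict_iff]
  have : sSup 𝒦 ≤ (Submodule.span ℂ
      {z | ∃ ξ, ∃ h ∈ (sSup 𝒦).toSubmodule, z = ρ.T i ξ h}).closure := sSup_le fun K hK => by
    obtain ⟨hr, hc⟩ := h K hK
    rw [isFullyCoisometric_restrict_iff] at hc
    refine le_trans (α := Submodule ℂ H) hc (Submodule.topologicalClosure_mono (Submodule.span_mono ?_))
    rintro _ ⟨ξ, u, hu, rfl⟩
    exact ⟨ξ, u, (le_sSup hK : K ≤ _) hu, rfl⟩
  exact this

end coisometric

variable {k : ℕ} {A : Type*} {X : (Fin k → ℕ) → Type*} [NonUnitalCStarAlgebra A] [PartialOrder A]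
  [StarOrderedRing A] [∀ m, NormedAddCommGroup (X m)]
  [∀ m, NormedSpace ℂ (X m)] [∀ m, Correspondence A (X m)]
  {P : ProductSystem A X} {H : Type v} [NormedAddCommGroup H] [InnerProductSpace ℂ H]
  [CompleteSpace H] {ρ : IsometricRep P basisDeg H}

theorem Reduces.coordPart {K : ClosedSubmodule ℂ H} (hK : ρ.Reduces K) (α : Set (Fin k)) :
    (ρ.coordPart α).Reduces K where
  invariant := ⟨hK.invariant.1, fun i => hK.invariant.2 i⟩
  invariant_orthogonal := ⟨hK.invariant_orthogonal.1, fun i => hK.invariant_orthogonal.2 i⟩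

theorem isInduced_coordPart_restrict_iff {K : ClosedSubmodule ℂ H} (hK : ρ.Reduces K)
    (α : Set (Fin k)) :
    ((ρ.restrict hK).coordPart α).IsInduced ↔ (ρ.coordPart α).IsInducedOn K.toSubmodule := by
  constructor
  · rintro ⟨K₀, _, _, _, π, hπ, U, hU, hU'⟩
    refine ⟨K₀, _, _, _, π, K.toSubmodule.subtypeₗᵢ.comp U.symm.toLinearIsometry, hπ,
      ⟨fun a f => ?_, fun i ξ f => ?_⟩, ?_⟩
    · obtain ⟨h, rfl⟩ := U.surjective f
      change ((U.symm (fockSigma π a (U h)) : K.toSubmodule) : H) = ρ.σ a (U.symm (U h) : _)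
      rw [U.symm_apply_apply, ← hK.coe_σ a h]
      exact congrArg Subtype.val (U.symm_apply_eq.mpr (hU a h).symm)
    · obtain ⟨h, rfl⟩ := U.surjective f
      change ((U.symm (fockCreationL π (P.restrict (supportedIn α)) (basisDegIn α i) ξ (U h)) : K.toSubmodule) : H) =
        ρ.T i ξ (U.symm (U h) : _)
      rw [U.symm_apply_apply, ← hK.coe_T i ξ h]
      exact congrArg Subtype.val (U.symm_apply_eq.mpr (hU' i ξ h).symm)
    · ext h
      constructor
      · rintro ⟨f, rfl⟩
        exact (U.symm f).2
      · exact fun hh => ⟨U ⟨h, hh⟩, congrArg Subtype.val (U.symm_apply_apply ⟨h, hh⟩)⟩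
  · rintro ⟨K₀, _, _, _, π, V, hπ, hV, hVK⟩
    let U : K.toSubmodule ≃ₗᵢ[ℂ] FockSpace (fun m : supportedIn α => X m) π :=
      (V.equivRange.trans (LinearIsometryEquiv.ofEq _ _ hVK)).symm
    have hU : ∀ h, V (U h) = h := fun h => congrArg Subtype.val (U.symm_apply_apply h)
    refine ⟨K₀, _, _, _, π, hπ, U, fun a h => V.injective ?_, fun i ξ h => V.injective ?_⟩
    · rw [hU]
      exact (hK.coe_σ a h).trans ((congrArg (ρ.σ a) (hU h).symm).trans (hV.sigma a _).symm)
    · rw [hU]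
      exact (hK.coe_T i ξ h).trans
        ((congrArg (ρ.T i ξ) (hU h).symm).trans (hV.creation i ξ _).symm)

theorem closure_range_basisDegIn (α : Set (Fin k)) :
    AddSubmonoid.closure (Set.range (basisDegIn α)) = ⊤ := by
  rw [eq_top_iff]
  rintro m -
  classical
  have hm : m = ∑ i : Fin k, if h : i ∈ α then m.1 i • basisDegIn α ⟨i, h⟩ else 0 := by
    ext j
    rw [AddSubmonoid.coe_finsetSum, Finset.sum_apply, Finset.sum_eq_single j]
    · by_cases h : j ∈ α
      · simp [h, basisDegIn, basisDeg]
      · simp [h, m.2 j h]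
    · intro i _ hij
      by_cases h : i ∈ α
      · simp [h, basisDegIn, basisDeg, Pi.single_eq_of_ne hij.symm]
      · simp [h]
    · simp
  rw [hm]
  refine AddSubmonoid.sum_mem _ fun i _ => ?_
  split_ifs with h
  · exact AddSubmonoid.nsmul_mem _ (AddSubmonoid.subset_closure (Set.mem_range_self _)) _
  · exact AddSubmonoid.zero_mem _

theorem isInducedCoisometricOn_sSup {α : Set (Fin k)} {𝒦 : Set (ClosedSubmodule ℂ H)}
    (h : ∀ K ∈ 𝒦, ρ.IsInducedCoisometricOn α K) : ρ.IsInducedCoisometricOn α (sSup 𝒦) where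
  reduces := reduces_sSup fun K hK => (h K hK).reduces
  induced := by
    rw [isInduced_coordPart_restrict_iff]
    refine isInducedOn_sSup (closure_range_basisDegIn α) (fun p q hpq => ?_)
      (fun K hK => (h K hK).reduces.coordPart α)
      fun K hK => (isInduced_coordPart_restrict_iff _ α).mp (h K hK).induced
    ext i
    have : p.1 i + q.1 i = 0 := congr(($hpq).1 i)
    exact (Nat.add_eq_zero_iff.mp this).1
  coisometric i hi := isFullyCoisometric_sSup
    (fun K hK => ⟨(h K hK).reduces, (h K hK).coisometric i hi⟩) _

end IsometricRep
end CorrProd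
end

theorem theorem3p1 {k : ℕ} {A : Type*} [NonUnitalCStarAlgebra A] [PartialOrder A]
    [StarOrderedRing A] {X : (Fin k → ℕ) → Type*} [∀ n, NormedAddCommGroup (X n)]
    [∀ n, NormedSpace ℂ (X n)] [∀ n, CorrProd.Correspondence A (X n)]
    (P : CorrProd.ProductSystem A X)
    {H : Type*} [NormedAddCommGroup H] [InnerProductSpace ℂ H] [CompleteSpace H]
    (ρ : CorrProd.IsometricRep P CorrProd.basisDeg H) (α : Set (Fin k)) :
    ∃ Hα : ClosedSubmodule ℂ H,
      IsGreatest {K : ClosedSubmodule ℂ H | ρ.IsInducedCoisometricOn α K} Hα ∧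
      ∀ K : ClosedSubmodule ℂ H, Maximal (ρ.IsInducedCoisometricOn α) K → K = Hα :=
  have hgood : ρ.IsInducedCoisometricOn α (sSup {K | ρ.IsInducedCoisometricOn α K}) :=
    CorrProd.IsometricRep.isInducedCoisometricOn_sSup fun _ hK => hK
  ⟨_, ⟨hgood, fun _ hK => le_sSup hK⟩, fun _ hK => hK.eq_of_le hgood (le_sSup hK.prop)⟩
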